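/- **Setting.** Write $pq$ for the (possibly undefined) output of the program with index $p$ on input $q$, for a standard numbering of the partial recursive functions; $\lambda$-terms over this partial combinatory algebra denote indices as usual. Let $\mathbf{p}ab = m(m+1)-a+b$ if $m=\max\{a,b\}$ is even and $m(m+1)+a-b$ if $m$ is odd; this is a recursive bijection $\mathbb N^2\to\mathbb N$ with inverses $\mathbf p_0,\mathbf p_1$. Let $\mathbf d abc_1c_2$ be $a$ if $c_1=c_2$ and $b$ otherwise. For $X\subseteq\mathbb N$ put $\overline n=\mathbf p0n$, $\overline{\mathbb N}=\mathbf p10$, $\overline X=\mathbf p11$, $\sigma ne=\mathbf p2(\mathbf pne)$, $\pi ne=\mathbf p3(\mathbf pne)$. The classes $\mathbf U,\mathbf V\subseteq\mathbb N$ and the relations $k\mathrel{\dot\in}n$, $k\mathrel{\dot\notin}n$ are the least ones such that: * $\overline n,\overline{\mathbb N},\overline X\in\mathbf U$; $k\mathrel{\dot\in}\overline n$ if $k<n$ and $k\mathrel{\dot\notin}\overline n$ if $k\ge n$; $k\mathrel{\dot\in}\overline{\mathbb N}$ always; $k\mathrel{\dot\in}\overline X$ if $k\in X$ and $k\mathrel{\dot\notin}\overline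 X$ if $k\notin X$; * if $n\in\mathbf U$ and for every $k$ either $k\mathrel{\dot\notin}n$ or $ek$ is defined and in $\mathbf U$, then $\sigma ne,\pi ne\in\mathbf U$; * if $\sigma ne\in\mathbf U$: $k\mathrel{\dot\in}n$ and $u\mathrel{\dot\in}ek$ give $\mathbf pku\mathrel{\dot\in}\sigma ne$; $k\mathrel{\dot\notin}n$ or $u\mathrel{\dot\notin}ek$ gives $\mathbf pku\mathrel{\dot\notin}\sigma ne$; * if $\pi ne\in\mathbf U$: $d\mathrel{\dot\in}\pi ne$ if for every $k$ either $k\mathrel{\dot\notin}n$ or $dk$ is defined and $dk\mathrel{\dot\in}ek$; $d\mathrel{\dot\notin}\pi ne$ if for some $k\mathrel{\dot\in}n$, either $dk$ is undefined or $dk\mathrel{\dot\notin}ek$; * if $n\in\mathbf U$ and for every $k$ either $k\mathrel{\dot\notin}n$ or $ek$ is defined and in $\mathbf V$, then $\mathbf pne\in\mathbf V$. By the recursion theorem, let $(\alpha\doteq\beta)=\sigma(\alpha\mathrel{\dot\subseteq}\beta)(\lambda x.\,\beta\mathrel{\dot\subseteq}\alpha)$, where $(\alpha\mathrel{\dot\subseteq}\beta)=\pi(\mathbf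 p_0\alpha)(\lambda x.\,\sigma(\mathbf p_0\beta)(\lambda y.\,\mathbf p_1\alpha x\doteq\mathbf p_1\beta y))$. Realisability of set-theoretic formulas with variables ranging over $\mathbf V$ is given by * $e\Vdash\alpha=\beta$ iff $e\mathrel{\dot\in}(\alpha\doteq\beta)$; $e\Vdash\alpha\in\beta$ iff $\mathbf p_0e\mathrel{\dot\in}\mathbf p_0\beta$ and $\mathbf p_1e\Vdash\alpha=\mathbf p_1\beta(\mathbf p_0e)$; * the usual Kleene clauses for the connectives ($e\Vdash\neg\varphi$ iff nothing realises $\varphi$; conjunctions by pairs; disjunctions by pairs with tag $0$ or $1$; implications by application); * $e\Vdash\forall x\in\alpha\,\varphi(x)$ iff for all $i\mathrel{\dot\in}\mathbf p_0\alpha$, $ei$ is defined and $ei\Vdash\varphi(\mathbf p_1\alpha i)$; $e\Vdash\exists x\in\alpha\,\varphi(x)$ iff $\mathbf p_0e\mathrel{\dot\in}\mathbf p_0\alpha$ and $\mathbf p_1e\Vdash\varphi(\mathbf p_1\alpha(\mathbf p_0e))$; * $e\Vdash\forall x\,\varphi(x)$ iff for all $\alpha\in\mathbf V$, $e\alpha$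 is defined and $e\alpha\Vdash\varphi(\alpha)$; $e\Vdash\exists x\,\varphi(x)$ iff $\mathbf p_0e\in\mathbf V$ and $\mathbf p_1e\Vdash\varphi(\mathbf p_0e)$. Let $\delta n=\mathbf pn\iota$ and $\iota=\mathbf p\delta\delta$. Let $n^V=\mathbf p\overline n(\lambda x.x^V)$, $\omega^V=\mathbf p\overline{\mathbb N}(\lambda x.x^V)$, $\{\alpha,\beta\}^V=\mathbf p\overline2(\lambda x.\mathbf d\alpha\beta x0)$, $\langle\alpha,\beta\rangle^V=\{\{\alpha,\alpha\}^V,\{\alpha,\beta\}^V\}^V$, and let $\overline p=\mathbf p\overline{\mathbb N}(\lambda x.\langle\langle(\mathbf p_0x)^V,(\mathbf p_1x)^V\rangle^V,x^V\rangle^V)$ represent the pairing function in the model. (Inside formulas, ordered pairs are Kuratowski pairs.) Fix any injective recursive coding of finite sequences of natural numbers by natural numbers, with elements $\mathbf l_s$ and $\mathbf t_s$ of the algebra such that $\mathbf l_st$ is the length of $t$ and $\mathbf t_stn$ codes the first $n$ components of $t$, for $n\le\mathbf l_st$. For $i,j,f\in\mathbb N$ with $i\ne j$, a finite sequence $t$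 satisfies the *requirement* $(i,j,f)$ if for some $n>i,j$ we have $\mathbf pin,\mathbf pjn\le\mathbf l_st$ and it is not the case that $f(\mathbf t_st(\mathbf pin))$ is defined and equal to $\mathbf t_st(\mathbf pjn)$. **Statement.** There is $h:\mathbb N\to\mathbb N$ such that every requirement is satisfied by some finite initial segment of $h$. Moreover, for every such $h$ the following holds. Let $X$ be the set of codes of the finite initial segments of $h$, let $\alpha_0=\mathbf p\overline X(\lambda t.(\mathbf l_st)^V)$, and let $f_0(i)$ denote the class $\{n\in\omega:\forall k\in n\ \overline p(i,k)\in\alpha_0\}$ of the realisability model for this $X$, where $\overline p(i,k)\in\alpha_0$ stands for $\exists x\in\overline p\,\exists n\in\alpha_0\ x=\langle\langle i,k\rangle,n\rangle$ and $f_0(i)\subseteq f_0(j)$ for $\forall n\,(n\in f_0(i)\to n\in f_0(j))$. 1. For all $i,j\in\mathbb N$, if some $d\Vdash f_0(i^V)\subseteq f_0(j^V)$, then $i=j$. 2. $\lambda ijx.\iota\Vdash\forall i,j\in\omega\,(f_0(i)\subseteq f_0(j)\to i=j)$. 3. The model realises that $f_0$ maps $\omega$ to ordinals in $\mathcal P(\omega)$: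 some $e$ realises $\forall i\in\omega\,\exists y\,(y=f_0(i)\land y\subseteq\omega\land y\text{ is an ordinal})$, where an ordinal is a transitive set of transitive sets. Thus $f_0$ is, in the model, an $\omega$-sequence of strongly incomparable ordinals in $\mathcal P(\omega)$. -/

import Mathlib

namespace RealModel

open Nat.Partrec (Code)

/-! ## The partial combinatory algebra of indices of computable functions -/

/-- Application `p q` in Kleene's first algebra: run the program with index `p` on input `q`. -/
def app (p q : ℕ) : Part ℕ := (Denumerable.ofNat Code p).eval q

/-- The pairing function `𝐩 a b`, defined by cases on the parity of `max a b`. -/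
def pr (a b : ℕ) : ℕ :=
  if max a b % 2 = 0 then max a b * (max a b + 1) + b - a
  else max a b * (max a b + 1) + a - b

/-- The first projection `𝐩₀`, given explicitly; see `pr0_pr`. -/
def pr0 (n : ℕ) : ℕ :=
  if n - n.sqrt * n.sqrt < n.sqrt then
    (if n.sqrt % 2 = 0 then n.sqrt else n - n.sqrt * n.sqrt)
  else (if n.sqrt % 2 = 0 then 2 * n.sqrt - (n - n.sqrt * n.sqrt) else n.sqrt)

/-- The second projection `𝐩₁`, given explicitly; see `pr1_pr`. -/
def pr1 (n : ℕ) : ℕ :=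
  if n - n.sqrt * n.sqrt < n.sqrt then
    (if n.sqrt % 2 = 0 then n - n.sqrt * n.sqrt else n.sqrt)
  else (if n.sqrt % 2 = 0 then n.sqrt else 2 * n.sqrt - (n - n.sqrt * n.sqrt))

theorem sqrt_pr (a b : ℕ) : (pr a b).sqrt = max a b := by
  symm
  rw [Nat.eq_sqrt]
  have h1 : a ≤ max a b := le_max_left a b
  have h2 : b ≤ max a b := le_max_right a b
  unfold pr
  generalize max a b = m at *
  have e1 : m * (m + 1) = m * m + m := by ring
  have e2 : (m + 1) * (m + 1) = m * m + 2 * m + 1 := by ring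
  rw [e1, e2]
  split <;> omega

theorem pr0_pr (a b : ℕ) : pr0 (pr a b) = a := by
  unfold pr0
  rw [sqrt_pr]
  unfold pr
  have e1 : max a b * (max a b + 1) = max a b * max a b + max a b := by ring
  rw [e1]
  generalize max a b * max a b = q
  rcases le_total a b with h | h
  · simp only [max_eq_right h]; split_ifs <;> omega
  · simp only [max_eq_left h]; split_ifs <;> omega

theorem pr1_pr (a b : ℕ) : pr1 (pr a b) = b := by
  unfold pr1
  rw [sqrt_pr]
  unfold pr
  have e1 : max a b * (max a b + 1) = max a b * max a b + max a b := by ring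
  rw [e1]
  generalize max a b * max a b = q
  rcases le_total a b with h | h
  · simp only [max_eq_right h]; split_ifs <;> omega
  · simp only [max_eq_left h]; split_ifs <;> omega

theorem primrec_pr : Primrec₂ pr := by
  have hm : Primrec fun x : ℕ × ℕ => max x.1 x.2 := Primrec.nat_max.comp Primrec.fst Primrec.snd
  have hq : Primrec fun x : ℕ × ℕ => max x.1 x.2 * (max x.1 x.2 + 1) :=
    Primrec.nat_mul.comp hm (Primrec.succ.comp hm)
  exact Primrec.ite
    (PrimrecRel.comp Primrec.eq (Primrec.nat_mod.comp hm (Primrec.const 2)) (Primrec.const 0))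
    (Primrec.nat_sub.comp (Primrec.nat_add.comp hq Primrec.snd) Primrec.fst)
    (Primrec.nat_sub.comp (Primrec.nat_add.comp hq Primrec.fst) Primrec.snd)

theorem primrec_pr0 : Primrec pr0 := by
  have hs : Primrec Nat.sqrt := Primrec.nat_sqrt
  have hr : Primrec fun n : ℕ => n - n.sqrt * n.sqrt :=
    Primrec.nat_sub.comp Primrec.id (Primrec.nat_mul.comp hs hs)
  have he : PrimrecPred fun n : ℕ => n.sqrt % 2 = 0 :=
    PrimrecRel.comp Primrec.eq (Primrec.nat_mod.comp hs (Primrec.const 2)) (Primrec.const 0)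
  exact Primrec.ite (PrimrecRel.comp Primrec.nat_lt hr hs) (Primrec.ite he hs hr)
    (Primrec.ite he (Primrec.nat_sub.comp (Primrec.nat_mul.comp (Primrec.const 2) hs) hr) hs)

theorem primrec_pr1 : Primrec pr1 := by
  have hs : Primrec Nat.sqrt := Primrec.nat_sqrt
  have hr : Primrec fun n : ℕ => n - n.sqrt * n.sqrt :=
    Primrec.nat_sub.comp Primrec.id (Primrec.nat_mul.comp hs hs)
  have he : PrimrecPred fun n : ℕ => n.sqrt % 2 = 0 :=
    PrimrecRel.comp Primrec.eq (Primrec.nat_mod.comp hs (Primrec.const 2)) (Primrec.const 0)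
  exact Primrec.ite (PrimrecRel.comp Primrec.nat_lt hr hs) (Primrec.ite he hr hs)
    (Primrec.ite he hs (Primrec.nat_sub.comp (Primrec.nat_mul.comp (Primrec.const 2) hs) hr))

/-! ## Lambda terms over the algebra

An abstraction denotes the index obtained by the s-m-n theorem (`Code.curry`) from a program for
its body; an environment is coded by iterating Mathlib's pairing `Nat.pair`. -/

theorem exists_code_app : ∃ c : Code, c.eval = fun n => app n.unpair.1 n.unpair.2 := by
  apply Nat.Partrec.Code.exists_code.1
  apply Partrec.nat_iff.1
  exact Nat.Partrec.Code.eval_part.comp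
    ((Computable.ofNat Code).comp (Computable.fst.comp Computable.unpair))
    (Computable.snd.comp Computable.unpair)

theorem exists_code_curry (b : Code) :
    ∃ c : Code, c.eval = fun r => Part.some (Encodable.encode (b.curry r)) := by
  apply Nat.Partrec.Code.exists_code.1
  apply Partrec.nat_iff.1
  have h : Computable fun r : ℕ => Encodable.encode (b.curry r) :=
    (Primrec.encode.comp
      (Nat.Partrec.Code.primrec₂_curry.comp (Primrec.const b) Primrec.id)).to_comp
  exact h.partrec

theorem exists_code_of_primrec {f : ℕ → ℕ} (hf : Primrec f) :
    ∃ c : Code, c.eval = fun n => Part.some (f n) := by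
  apply Nat.Partrec.Code.exists_code.1
  apply Partrec.nat_iff.1
  exact hf.to_comp.partrec

theorem exists_code_pr : ∃ c : Code, c.eval = fun n => Part.some (pr n.unpair.1 n.unpair.2) :=
  exists_code_of_primrec (primrec_pr.comp (Primrec.fst.comp Primrec.unpair)
    (Primrec.snd.comp Primrec.unpair))

theorem exists_code_pr0 : ∃ c : Code, c.eval = fun n => Part.some (pr0 n) :=
  exists_code_of_primrec primrec_pr0

theorem exists_code_pr1 : ∃ c : Code, c.eval = fun n => Part.some (pr1 n) :=
  exists_code_of_primrec primrec_pr1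

/-- `𝐝 a b c₁ c₂`: `a` if `c₁ = c₂`, and `b` otherwise. -/
def dec (a b c₁ c₂ : ℕ) : ℕ := if c₁ = c₂ then a else b

theorem exists_code_dec : ∃ c : Code, c.eval = fun n => Part.some
    (dec n.unpair.1.unpair.1 n.unpair.1.unpair.2 n.unpair.2.unpair.1 n.unpair.2.unpair.2) := by
  have h1 : Primrec fun n : ℕ => n.unpair.1 := Primrec.fst.comp Primrec.unpair
  have h2 : Primrec fun n : ℕ => n.unpair.2 := Primrec.snd.comp Primrec.unpair
  exact exists_code_of_primrec (Primrec.ite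
    (PrimrecRel.comp Primrec.eq (h1.comp h2) (h2.comp h2)) (h1.comp h1) (h2.comp h1))

/-- Lambda terms (de Bruijn indices) over the algebra. -/
inductive Tm : Type
  /-- the variable bound by the `i`-th enclosing abstraction, counted from the inside -/
  | var (i : ℕ) : Tm
  /-- an element of the algebra -/
  | cst (c : ℕ) : Tm
  /-- application -/
  | ap (t u : Tm) : Tm
  /-- abstraction -/
  | lam (t : Tm) : Tm
  /-- `𝐩 t u` -/
  | pr (t u : Tm) : Tm
  /-- `𝐩₀ t` -/
  | pr0 (t : Tm) : Tm
  /-- `𝐩₁ t` -/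
  | pr1 (t : Tm) : Tm
  /-- `𝐝 t u v w` -/
  | dec (t u v w : Tm) : Tm

/-- A program computing the value of a term from the coded environment. -/
noncomputable def Tm.compile : Tm → Code
  | .var 0 => Code.right
  | .var (i + 1) => ((Tm.var i).compile).comp Code.left
  | .cst c => Code.const c
  | .ap t u => exists_code_app.choose.comp (t.compile.pair u.compile)
  | .lam t => (exists_code_curry t.compile).choose
  | .pr t u => exists_code_pr.choose.comp (t.compile.pair u.compile)
  | .pr0 t => exists_code_pr0.choose.comp t.compile
  | .pr1 t => exists_code_pr1.choose.comp t.compile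
  | .dec t u v w => exists_code_dec.choose.comp
      ((t.compile.pair u.compile).pair (v.compile.pair w.compile))

/-- The value of a term in the environment coded by `r`. -/
noncomputable def Tm.eval (t : Tm) (r : ℕ) : Part ℕ := t.compile.eval r

/-- The index `λx. t`, with the remaining variables of `t` read in the environment `r`. -/
noncomputable def closure (t : Tm) (r : ℕ) : ℕ := Encodable.encode (t.compile.curry r)

/-- The closed abstraction `λx. t`. -/
noncomputable def lamC (t : Tm) : ℕ := closure t 0

/-- The closed term `W W` for `W = λz. λx. t`, evaluated. In `t` the variable `0` is the argument
`x`, and the term `self 1`, i.e. `z z`, has this very element as its value. -/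
noncomputable def recLam (t : Tm) : ℕ := closure t (Nat.pair 0 (lamC (.lam t)))

/-- The term `z z` for the variable `z` with de Bruijn index `i`. -/
def self (i : ℕ) : Tm := .ap (.var i) (.var i)

theorem app_closure (t : Tm) (r x : ℕ) : app (closure t r) x = t.eval (Nat.pair r x) := by
  simp [app, closure, Tm.eval, Nat.Partrec.Code.eval_curry]

theorem eval_var_zero (r x : ℕ) : (Tm.var 0).eval (Nat.pair r x) = Part.some x := by
  simp [Tm.eval, Tm.compile, Code.eval]

theorem eval_var_succ (i r x : ℕ) : (Tm.var (i + 1)).eval (Nat.pair r x) = (Tm.var i).eval r := by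
  have h : (Tm.var (i + 1)).eval (Nat.pair r x) =
      (Part.some (Nat.unpair (Nat.pair r x)).1).bind (Tm.var i).compile.eval := by
    simp only [Tm.eval, Tm.compile, Code.eval]; rfl
  rw [h, Nat.unpair_pair]
  exact Part.bind_some _ _

theorem eval_cst (c r : ℕ) : (Tm.cst c).eval r = Part.some c := by
  simp [Tm.eval, Tm.compile]

theorem eval_lam (t : Tm) (r : ℕ) : (Tm.lam t).eval r = Part.some (closure t r) := by
  simp [Tm.eval, Tm.compile, (exists_code_curry t.compile).choose_spec, closure]

theorem eval_ap (t u : Tm) (r : ℕ) :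
    (Tm.ap t u).eval r = (t.eval r).bind fun a => (u.eval r).bind fun b => app a b := by
  simp [Tm.eval, Tm.compile, Code.eval, exists_code_app.choose_spec, Seq.seq, Part.bind_assoc,
    ← Part.bind_some_eq_map]

theorem eval_pr (t u : Tm) (r : ℕ) : (Tm.pr t u).eval r =
    (t.eval r).bind fun a => (u.eval r).bind fun b => Part.some (pr a b) := by
  simp [Tm.eval, Tm.compile, Code.eval, exists_code_pr.choose_spec, Seq.seq, Part.bind_assoc,
    ← Part.bind_some_eq_map]

theorem eval_pr0 (t : Tm) (r : ℕ) :
    (Tm.pr0 t).eval r = (t.eval r).bind fun a => Part.some (pr0 a) := by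
  simp [Tm.eval, Tm.compile, Code.eval, exists_code_pr0.choose_spec]

theorem eval_pr1 (t : Tm) (r : ℕ) :
    (Tm.pr1 t).eval r = (t.eval r).bind fun a => Part.some (pr1 a) := by
  simp [Tm.eval, Tm.compile, Code.eval, exists_code_pr1.choose_spec]

theorem eval_dec (t u v w : Tm) (r : ℕ) : (Tm.dec t u v w).eval r =
    (t.eval r).bind fun a => (u.eval r).bind fun b => (v.eval r).bind fun c =>
      (w.eval r).bind fun d => Part.some (dec a b c d) := by
  simp [Tm.eval, Tm.compile, Code.eval, exists_code_dec.choose_spec, Seq.seq, Part.bind_assoc,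
    ← Part.bind_some_eq_map]

theorem app_lamC (t : Tm) (x : ℕ) : app (lamC t) x = t.eval (Nat.pair 0 x) := app_closure t 0 x

theorem app_recLam (t : Tm) (x : ℕ) :
    app (recLam t) x = t.eval (Nat.pair (Nat.pair 0 (lamC (.lam t))) x) := app_closure t _ x

/-- Inside `recLam t`, the term `z z` denotes `recLam t`. -/
theorem app_lamC_lam_self (t : Tm) :
    app (lamC (.lam t)) (lamC (.lam t)) = Part.some (recLam t) := by
  rw [app_lamC, eval_lam]; rfl

/-! ## The type structure -/

/-- The finite type with `n` elements. -/
def finC (n : ℕ) : ℕ := pr 0 n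

/-- The type of natural numbers. -/
def natC : ℕ := pr 1 0

/-- The distinguished type. -/
def xC : ℕ := pr 1 1

/-- The type constructor `σ` (dependent sum). -/
def sigmaC (n e : ℕ) : ℕ := pr 2 (pr n e)

/-- The type constructor `π` (dependent product). -/
def piC (n e : ℕ) : ℕ := pr 3 (pr n e)

/-- The statements generated by the simultaneous inductive definition. -/
inductive Judgment : Type
  /-- `n ∈ 𝐔` -/
  | type (n : ℕ) : Judgment
  /-- `α ∈ 𝐕` -/
  | set (α : ℕ) : Judgment
  /-- `k` is an element of the type `n` -/
  | mem (k n : ℕ) : Judgment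
  /-- `k` is a non-element of the type `n` -/
  | nmem (k n : ℕ) : Judgment

/-- The simultaneous inductive definition of `𝐔`, `𝐕`, elementhood and non-elementhood. A premise
"for all `k`, either `A k` or `B k`" is given by the set `D` of those `k` for which `B k` is
derived, `A k` being derived for the others; `m ∈ app e k` says that `e k` is defined and equal to
`m`. -/
inductive Derivable (X : Set ℕ) : Judgment → Prop
  | fin_type (n : ℕ) : Derivable X (.type (finC n))
  | fin_mem (k n : ℕ) (h : k < n) : Derivable X (.mem k (finC n))
  | fin_nmem (k n : ℕ) (h : n ≤ k) : Derivable X (.nmem k (finC n))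
  | nat_type : Derivable X (.type natC)
  | x_type : Derivable X (.type xC)
  | nat_mem (n : ℕ) : Derivable X (.mem n natC)
  | x_mem (n : ℕ) (h : n ∈ X) : Derivable X (.mem n xC)
  | x_nmem (n : ℕ) (h : n ∉ X) : Derivable X (.nmem n xC)
  | sigma_type (n e : ℕ) (D : Set ℕ) (f : ℕ → ℕ) (hn : Derivable X (.type n))
      (hA : ∀ k, k ∉ D → Derivable X (.nmem k n))
      (hf : ∀ k ∈ D, f k ∈ app e k) (hB : ∀ k ∈ D, Derivable X (.type (f k))) :
      Derivable X (.type (sigmaC n e))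
  | pi_type (n e : ℕ) (D : Set ℕ) (f : ℕ → ℕ) (hn : Derivable X (.type n))
      (hA : ∀ k, k ∉ D → Derivable X (.nmem k n))
      (hf : ∀ k ∈ D, f k ∈ app e k) (hB : ∀ k ∈ D, Derivable X (.type (f k))) :
      Derivable X (.type (piC n e))
  | sigma_mem (n e k u m : ℕ) (h : Derivable X (.type (sigmaC n e))) (hm : m ∈ app e k)
      (hk : Derivable X (.mem k n)) (hu : Derivable X (.mem u m)) :
      Derivable X (.mem (pr k u) (sigmaC n e))
  | sigma_nmem_left (n e k u : ℕ) (h : Derivable X (.type (sigmaC n e)))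
      (hk : Derivable X (.nmem k n)) : Derivable X (.nmem (pr k u) (sigmaC n e))
  | sigma_nmem_right (n e k u m : ℕ) (h : Derivable X (.type (sigmaC n e))) (hm : m ∈ app e k)
      (hu : Derivable X (.nmem u m)) : Derivable X (.nmem (pr k u) (sigmaC n e))
  | pi_mem (n e d : ℕ) (D : Set ℕ) (f g : ℕ → ℕ) (h : Derivable X (.type (piC n e)))
      (hA : ∀ k, k ∉ D → Derivable X (.nmem k n))
      (hf : ∀ k ∈ D, f k ∈ app d k) (hg : ∀ k ∈ D, g k ∈ app e k)
      (hB : ∀ k ∈ D, Derivable X (.mem (f k) (g k))) : Derivable X (.mem d (piC n e))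
  | pi_nmem (n e d k m : ℕ) (h : Derivable X (.type (piC n e))) (hk : Derivable X (.mem k n))
      (hm : ∀ v ∈ app d k, m ∈ app e k) (hB : ∀ v ∈ app d k, Derivable X (.nmem v m)) :
      Derivable X (.nmem d (piC n e))
  | set (n e : ℕ) (D : Set ℕ) (f : ℕ → ℕ) (hn : Derivable X (.type n))
      (hA : ∀ k, k ∉ D → Derivable X (.nmem k n))
      (hf : ∀ k ∈ D, f k ∈ app e k) (hB : ∀ k ∈ D, Derivable X (.set (f k))) :
      Derivable X (.set (pr n e))

/-- The class `𝐔` of types. -/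
def U (X : Set ℕ) : Set ℕ := {n | Derivable X (.type n)}

/-- The class `𝐕` over which the variables of set theory range. -/
def V (X : Set ℕ) : Set ℕ := {α | Derivable X (.set α)}

/-- `k` is an element of the type `n`. -/
def El (X : Set ℕ) (k n : ℕ) : Prop := Derivable X (.mem k n)

/-! ## Equality of sets as a type -/

/-- The term `σ t u`. -/
def Tm.sigma (t u : Tm) : Tm := .pr (.cst 2) (.pr t u)

/-- The term `π t u`. -/
def Tm.pi (t u : Tm) : Tm := .pr (.cst 3) (.pr t u)

/-- The term `π (𝐩₀ α) (λx. σ (𝐩₀ β) (λy. (z z) (𝐩₁ α x) (𝐩₁ β y)))`, for the variables `z`, `α`,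
`β` with the given de Bruijn indices. -/
def subTm (z α β : ℕ) : Tm :=
  .pi (.pr0 (.var α)) (.lam (.sigma (.pr0 (.var (β + 1))) (.lam
    (.ap (.ap (self (z + 2)) (.ap (.pr1 (.var (α + 2))) (.var 1)))
      (.ap (.pr1 (.var (β + 2))) (.var 0))))))

/-- The element `λα β. σ (α ⊆ β) (λx. β ⊆ α)`, where
`α ⊆ β` is `π (𝐩₀ α) (λx. σ (𝐩₀ β) (λy. 𝐩₁ α x = 𝐩₁ β y))`, by recursion. -/
noncomputable def eqC : ℕ := recLam (.lam (.sigma (subTm 2 1 0) (.lam (subTm 3 1 2))))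

/-! ## Realisability -/

/-- Formulas of set theory with parameters in `ℕ`; a quantifier acts on the family of instances of
its scope. -/
inductive Fml : Type
  | eq (a b : ℕ) : Fml
  | mem (a b : ℕ) : Fml
  | neg (φ : Fml) : Fml
  | and (φ ψ : Fml) : Fml
  | or (φ ψ : Fml) : Fml
  | imp (φ ψ : Fml) : Fml
  /-- `∀ x ∈ a, φ x` -/
  | ball (a : ℕ) (φ : ℕ → Fml) : Fml
  /-- `∃ x ∈ a, φ x` -/
  | bex (a : ℕ) (φ : ℕ → Fml) : Fml
  | all (φ : ℕ → Fml) : Fml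
  | ex (φ : ℕ → Fml) : Fml

/-- `e` realises `a = b`: it is an element of the type computed by `eqC` from `a` and `b`. -/
def RealizesEq (X : Set ℕ) (e a b : ℕ) : Prop :=
  ∃ c ∈ (app eqC a).bind (fun q => app q b), El X e c

/-- `Realizes X φ e`: the number `e` realises `φ`. -/
def Realizes (X : Set ℕ) : Fml → ℕ → Prop
  | .eq a b, e => RealizesEq X e a b
  | .mem a b, e => El X (pr0 e) (pr0 b) ∧ ∃ c ∈ app (pr1 b) (pr0 e), RealizesEq X (pr1 e) a c
  | .neg φ, _ => ∀ d, ¬ Realizes X φ d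
  | .and φ ψ, e => Realizes X φ (pr0 e) ∧ Realizes X ψ (pr1 e)
  | .or φ ψ, e => (pr0 e = 0 ∧ Realizes X φ (pr1 e)) ∨ (pr0 e = 1 ∧ Realizes X ψ (pr1 e))
  | .imp φ ψ, e => ∀ d, Realizes X φ d → ∃ v ∈ app e d, Realizes X ψ v
  | .ball a φ, e => ∀ i, El X i (pr0 a) →
      ∃ v ∈ app e i, ∃ c ∈ app (pr1 a) i, Realizes X (φ c) v
  | .bex a φ, e => El X (pr0 e) (pr0 a) ∧
      ∃ c ∈ app (pr1 a) (pr0 e), Realizes X (φ c) (pr1 e)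
  | .all φ, e => ∀ α ∈ V X, ∃ v ∈ app e α, Realizes X (φ α) v
  | .ex φ, e => pr0 e ∈ V X ∧ Realizes X (φ (pr0 e)) (pr1 e)

/-! ## Standard objects of the model -/

/-- The element `δ` with `δ n = 𝐩 n ι`, where `ι = 𝐩 δ δ`. -/
noncomputable def deltaR : ℕ := recLam (.pr (.var 0) (.pr (self 1) (self 1)))

/-- The element `ι = 𝐩 δ δ`, which realises `α = α` for every `α ∈ 𝐕`. -/
noncomputable def iotaR : ℕ := pr deltaR deltaR

/-- The element `λx. x^V`, given by recursion as `λx. 𝐩 (finC x) (λy. y^V)`. -/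
noncomputable def numC : ℕ := recLam (.pr (.pr (.cst 0) (.var 0)) (self 1))

/-- The numeral `n^V`. -/
noncomputable def numV (n : ℕ) : ℕ := pr (finC n) numC

/-- The element `ω^V`. -/
noncomputable def omegaV : ℕ := pr natC numC

/-- The element `λα β. {α, β}^V`, with `{α, β}^V = 𝐩 (finC 2) (λx. 𝐝 α β x 0)`. -/
noncomputable def upairC : ℕ :=
  lamC (.lam (.pr (.cst (finC 2)) (.lam (.dec (.var 2) (.var 1) (.var 0) (.cst 0)))))

/-- The term `{t, u}^V`. -/
noncomputable def Tm.upair (t u : Tm) : Tm := .ap (.ap (.cst upairC) t) u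

/-- The term `⟨t, u⟩^V = {{t, t}^V, {t, u}^V}^V`. -/
noncomputable def Tm.opair (t u : Tm) : Tm := .upair (.upair t t) (.upair t u)

/-- The pairing function as a set of the model,
`𝐩 ℕ (λx. ⟨⟨(𝐩₀ x)^V, (𝐩₁ x)^V⟩^V, x^V⟩^V)`. -/
noncomputable def pairV : ℕ :=
  pr natC (lamC (.opair (.opair (.ap (.cst numC) (.pr0 (.var 0))) (.ap (.cst numC) (.pr1 (.var 0))))
    (.ap (.cst numC) (.var 0))))

/-! ## Formulas of set theory -/

namespace Fml

/-- `w = {a, b}` -/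
def isUPair (w a b : ℕ) : Fml :=
  .and (.mem a w) (.and (.mem b w) (.ball w fun v => .or (.eq v a) (.eq v b)))

/-- `x = ⟨a, b⟩ = {{a}, {a, b}}` -/
def isOPair (x a b : ℕ) : Fml :=
  .and (.bex x fun w => isUPair w a a) (.and (.bex x fun w => isUPair w a b)
    (.ball x fun w => .or (isUPair w a a) (isUPair w a b)))

/-- `x = ⟨⟨a, b⟩, c⟩`: some member `u` of a member of `x` is `⟨a, b⟩`, and `x = ⟨u, c⟩`. -/
def isOTriple (x a b c : ℕ) : Fml :=
  .bex x fun w => .bex w fun u => .and (isOPair u a b) (isOPair x u c)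

/-- `a ⊆ b` -/
def subset (a b : ℕ) : Fml := .ball a fun x => .mem x b

/-- `a` is a transitive set. -/
def isTransitive (a : ℕ) : Fml := .ball a fun x => .ball x fun y => .mem y a

/-- `a` is an ordinal: a transitive set of transitive sets. -/
def isOrd (a : ℕ) : Fml := .and (isTransitive a) (.ball a isTransitive)

end Fml

/-! ## The coding of sequences and the requirements -/

/-- A recursive coding of the finite sequences of natural numbers by natural numbers, with elements
of the algebra that compute length and truncation. -/
structure SeqCoding where
  /-- the code of a sequence -/
  code : List ℕ → ℕ
  code_injective : Function.Injective code
  code_computable : Computable code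
  /-- the element `l_s` -/
  len : ℕ
  len_spec : ∀ s : List ℕ, app len (code s) = Part.some s.length
  /-- the element `t_s` -/
  trunc : ℕ
  trunc_spec : ∀ (s : List ℕ) (n : ℕ), n ≤ s.length →
    (app trunc (code s)).bind (fun q => app q n) = Part.some (code (s.take n))

namespace SeqCoding

/-- The requirement for `i`, `j`, `f` on a finite sequence `s`: for some `n > i, j` such that `s`
has at least `𝐩 i n` and `𝐩 j n` components, `f` does not compute (the code of) the first `𝐩 j n`
components of `s` from the first `𝐩 i n`. -/
def Requirement (c : SeqCoding) (i j f : ℕ) (s : List ℕ) : Prop :=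
  ∃ n, i < n ∧ j < n ∧ pr i n ≤ s.length ∧ pr j n ≤ s.length ∧
    ∀ v ∈ app f (c.code (s.take (pr i n))), v ≠ c.code (s.take (pr j n))

/-- The initial segment of `h` of length `l`. -/
def initSeg (h : ℕ → ℕ) (l : ℕ) : List ℕ := (List.range l).map h

/-- Every requirement with `i ≠ j` is satisfied by some finite initial segment of `h`. -/
def MeetsAll (c : SeqCoding) (h : ℕ → ℕ) : Prop :=
  ∀ i j f, i ≠ j → ∃ l, c.Requirement i j f (initSeg h l)

/-- The set `X` of the codes of the finite initial segments of `h`. -/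
def segs (c : SeqCoding) (h : ℕ → ℕ) : Set ℕ := {t | ∃ l, t = c.code (initSeg h l)}

/-- The set `α₀ = 𝐩 X (λt. (l_s t)^V)` of the model. -/
noncomputable def alphaV (c : SeqCoding) : ℕ :=
  pr xC (lamC (.ap (.cst numC) (.ap (.cst c.len) (.var 0))))

/-- The formula `p(i, k) ∈ α₀`, for the pairing function `p` of the model. -/
noncomputable def pairMem (c : SeqCoding) (i k : ℕ) : Fml :=
  .bex pairV fun x => .bex c.alphaV fun n => .isOTriple x i k n

/-- The formula `n ∈ f₀(i)`, where `f₀(i) = {n ∈ ω : ∀ k ∈ n, p(i, k) ∈ α₀}`. -/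
noncomputable def memF (c : SeqCoding) (n i : ℕ) : Fml :=
  .and (.mem n omegaV) (.ball n fun k => c.pairMem i k)

/-- The formula `f₀(i) ⊆ f₀(j)`. -/
noncomputable def subF (c : SeqCoding) (i j : ℕ) : Fml :=
  .all fun n => .imp (c.memF n i) (c.memF n j)

/-- The formula `y = f₀(i)`: every element of `y` belongs to `f₀(i)`, and every `n ∈ ω` with
`∀ k ∈ n, p(i, k) ∈ α₀` is an element of `y`. -/
noncomputable def isF (c : SeqCoding) (y i : ℕ) : Fml :=
  .and (.ball y fun n => c.memF n i)
    (.ball omegaV fun n => .imp (.ball n fun k => c.pairMem i k) (.mem n y))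

end SeqCoding

end RealModel

namespace RealModel

/-! ## Types and their elements -/

/-! The core is that a realiser of `𝐩(i, k) ∈ α₀` must carry the code of the initial segment of `h`
of length `𝐩 i k`. Its index into `α₀` lies in `X`, hence codes some segment, and the equation it
realises between hereditarily finite sets is true of the sets named (`Names.eq_of_realizes`), so the
length is `𝐩 i k` (`SeqCoding.eq_of_realizes_pairMem`).

Incomparability. From the segment of length `𝐩 i n` with `i < n`, one recovers `n` and, by
truncation, all segments of length `𝐩 i k` with `k ≤ n`; this is enough to realise `n + 1 ∈ f₀(i)`.
A realiser of `f₀(i) ⊆ f₀(j)` then yields a realiser of `n + 1 ∈ f₀(j)`, whose instance at `n`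
contains the segment of length `𝐩 j n`. So one program computes the latter segment from the former
for all `n > i` (`SeqCoding.exists_program`), which the requirements forbid unless `i = j`.

Existence of `h` is a finite extension argument. The parity twist in `𝐩` gives arbitrarily large `n`
with `𝐩 i n < 𝐩 j n`, whatever the order of `i` and `j`. A program reading the first `𝐩 i n` entries
commits itself to at most one continuation, and a later entry can be chosen to refute it.

Finally, `f₀(i)` has a name in the model: its index type consists of the pairs of a number `n` and a
function listing the segments of length `𝐩 i k` for `k < n`. Its elements hold just the data carried
by realisers of `n ∈ f₀(i)`, and restricting the function to a smaller number gives transitivity. -/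

theorem pr_inj {a b c d : ℕ} : pr a b = pr c d ↔ a = c ∧ b = d :=
  ⟨fun h => ⟨by rw [← pr0_pr a b, h, pr0_pr], by rw [← pr1_pr a b, h, pr1_pr]⟩,
    fun ⟨h₁, h₂⟩ => by rw [h₁, h₂]⟩

section Types

variable {X : Set ℕ}

theorem El_finC {k n : ℕ} : El X k (finC n) ↔ k < n := by
  refine ⟨fun h => ?_, fun h => .fin_mem k n h⟩
  unfold El at h
  generalize hJ : Judgment.mem k (finC n) = J at h
  cases h <;> simp_all [pr_inj, finC, natC, xC, sigmaC, piC]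

theorem El_natC (k : ℕ) : El X k natC := .nat_mem k

theorem El_xC {k : ℕ} : El X k xC ↔ k ∈ X := by
  refine ⟨fun h => ?_, fun h => .x_mem k h⟩
  unfold El at h
  generalize hJ : Judgment.mem k xC = J at h
  cases h <;> simp_all [pr_inj, finC, natC, xC, sigmaC, piC]

/-- The one case of consistency between elementhood and non-elementhood that is needed. It
guarantees that an element of a product over a finite type really is defined at every `k < n`. -/
theorem not_nmem_finC {k n : ℕ} (hk : k < n) : ¬ Derivable X (.nmem k (finC n)) := by
  intro h
  generalize hJ : Judgment.nmem k (finC n) = J at h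
  cases h <;> simp_all [pr_inj, finC, natC, xC, sigmaC, piC]
  omega

/-- Every number that is not an element of the type `n` is derivably a non-element. -/
def Decided (X : Set ℕ) (n : ℕ) : Prop :=
  Derivable X (.type n) ∧ ∀ k, ¬ El X k n → Derivable X (.nmem k n)

theorem decided_finC (n : ℕ) : Decided X (finC n) :=
  ⟨.fin_type n, fun k hk => .fin_nmem k n (not_lt.1 fun h => hk (El_finC.2 h))⟩

theorem decided_natC : Decided X natC := ⟨.nat_type, fun k hk => absurd (El_natC k) hk⟩

theorem decided_xC : Decided X xC :=
  ⟨.x_type, fun k hk => .x_nmem k fun h => hk (El_xC.2 h)⟩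

theorem exists_fun_of_El {n e : ℕ} {P : ℕ → Prop}
    (h : ∀ k, El X k n → ∃ c ∈ app e k, P c) :
    ∃ f : ℕ → ℕ, ∀ k, El X k n → f k ∈ app e k ∧ P (f k) := by
  choose! f hf using h
  exact ⟨f, hf⟩

theorem Decided.sigma_type {n e : ℕ} (hn : Decided X n)
    (h : ∀ k, El X k n → ∃ c ∈ app e k, Derivable X (.type c)) :
    Derivable X (.type (sigmaC n e)) := by
  obtain ⟨f, hf⟩ := exists_fun_of_El h
  exact .sigma_type n e {k | El X k n} f hn.1 hn.2 (fun k hk => (hf k hk).1) fun k hk => (hf k hk).2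

theorem Decided.pi_type {n e : ℕ} (hn : Decided X n)
    (h : ∀ k, El X k n → ∃ c ∈ app e k, Derivable X (.type c)) :
    Derivable X (.type (piC n e)) := by
  obtain ⟨f, hf⟩ := exists_fun_of_El h
  exact .pi_type n e {k | El X k n} f hn.1 hn.2 (fun k hk => (hf k hk).1) fun k hk => (hf k hk).2

theorem Decided.set {n e : ℕ} (hn : Decided X n)
    (h : ∀ k, El X k n → ∃ c ∈ app e k, c ∈ V X) : pr n e ∈ V X := by
  obtain ⟨f, hf⟩ := exists_fun_of_El h
  exact .set n e {k | El X k n} f hn.1 hn.2 (fun k hk => (hf k hk).1) fun k hk => (hf k hk).2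

theorem Decided.pi_mem {n e d : ℕ} (hn : Decided X n) (ht : Derivable X (.type (piC n e)))
    (h : ∀ k, El X k n → ∃ v ∈ app d k, ∃ c ∈ app e k, El X v c) : El X d (piC n e) := by
  choose! f hf g hg h using h
  exact .pi_mem n e d {k | El X k n} f g ht hn.2 hf hg h

theorem sigma_elim {n e d : ℕ} (h : El X d (sigmaC n e)) :
    El X (pr0 d) n ∧ ∃ c ∈ app e (pr0 d), El X (pr1 d) c := by
  unfold El at h
  generalize hJ : Judgment.mem d (sigmaC n e) = J at h
  cases h with
  | sigma_mem n' e' k u m _ hm hk hu =>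
    simp only [sigmaC, Judgment.mem.injEq, pr_inj, true_and] at hJ
    obtain ⟨rfl, rfl, rfl⟩ := hJ
    rw [pr0_pr, pr1_pr]
    exact ⟨hk, m, hm, hu⟩
  | _ => simp [pr_inj, finC, natC, xC, sigmaC, piC] at hJ

theorem pi_elim {n e d k : ℕ} (h : El X d (piC n e)) (hk : ¬ Derivable X (.nmem k n)) :
    ∃ v ∈ app d k, ∃ c ∈ app e k, El X v c := by
  unfold El at h
  generalize hJ : Judgment.mem d (piC n e) = J at h
  cases h with
  | pi_mem n' e' d' D f g _ hA hf hg hB =>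
    simp only [piC, Judgment.mem.injEq, pr_inj, true_and] at hJ
    obtain ⟨rfl, rfl, rfl⟩ := hJ
    have hD : k ∈ D := by_contra fun h => hk (hA k h)
    exact ⟨f k, hf k hD, g k, hg k hD, hB k hD⟩
  | _ => simp [pr_inj, finC, natC, xC, sigmaC, piC] at hJ

end Types

/-! ## Evaluation of the standard terms -/

theorem app_numC (n : ℕ) : app numC n = Part.some (numV n) := by
  simp only [numC, app_recLam, eval_pr, eval_cst, eval_var_zero, self, eval_ap, eval_var_succ,
    Part.bind_some, app_lamC_lam_self]
  rfl

theorem app_deltaR (n : ℕ) : app deltaR n = Part.some (pr n iotaR) := by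
  simp only [deltaR, app_recLam, eval_pr, eval_var_zero, self, eval_ap, eval_var_succ,
    Part.bind_some, app_lamC_lam_self]
  rfl

/-- The type of realisers of `a = b`. -/
noncomputable def eqType (a b : ℕ) : Part ℕ := (app eqC a).bind fun q => app q b

/-- `s` is a type of the form `a ⊆ b`. -/
def IsSubsetType (s a b : ℕ) : Prop :=
  ∃ e, ∃ g : ℕ → ℕ, s = piC (pr0 a) e ∧ (∀ x, app e x = Part.some (sigmaC (pr0 b) (g x))) ∧
    ∀ x y p q, p ∈ app (pr1 a) x → q ∈ app (pr1 b) y → app (g x) y = eqType p q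

/-- The environment enters only through the values of three variables, so the same lemma serves both
inclusions, the second of which sits under an additional binder with the roles of the two sets
exchanged. -/
theorem eval_subTm {z i j r a b : ℕ} (hz : (self z).eval r = Part.some eqC)
    (hi : (Tm.var i).eval r = Part.some a) (hj : (Tm.var j).eval r = Part.some b) :
    ∃ s, (subTm z i j).eval r = Part.some s ∧ IsSubsetType s a b := by
  have hz' (x y : ℕ) : (self (z + 2)).eval (Nat.pair (Nat.pair r x) y) = Part.some eqC := by
    rw [← hz]
    simp only [self, eval_ap, eval_var_succ]
  simp only [subTm, Tm.pi, eval_pr, eval_pr0, eval_cst, eval_lam, hi, Part.bind_some]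
  refine ⟨_, rfl, _, fun x => closure (.ap (.ap (self (z + 2)) (.ap (.pr1 (.var (i + 2)))
    (.var 1))) (.ap (.pr1 (.var (j + 2))) (.var 0))) (Nat.pair r x), rfl, fun x => ?_,
    fun x y p q hp hq => ?_⟩
  · simp only [app_closure, Tm.sigma, eval_pr, eval_pr0, eval_cst, eval_lam, eval_var_succ, hj,
      Part.bind_some]
    rfl
  · have h₁ : (Tm.var 1).eval (Nat.pair (Nat.pair r x) y) = Part.some x := by
      rw [eval_var_succ, eval_var_zero]
    simp only [app_closure, eval_ap, eval_pr1, eval_var_zero, h₁, eval_var_succ, hi, hj, hz',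
      Part.bind_some, Part.eq_some_iff.2 hp, Part.eq_some_iff.2 hq]
    rfl

theorem exists_eqType (a b : ℕ) : ∃ s e, ∃ s' : ℕ → ℕ, eqType a b = Part.some (sigmaC s e) ∧
    IsSubsetType s a b ∧ ∀ x, app e x = Part.some (s' x) ∧ IsSubsetType (s' x) b a := by
  set T : Tm := .lam (.sigma (subTm 2 1 0) (.lam (subTm 3 1 2))) with hT
  -- The environment of the body of `eqC`: the recursion variable, then `a`, then `b`.
  set r := Nat.pair (Nat.pair (Nat.pair 0 (lamC (.lam T))) a) b with hr
  have hz : (self 2).eval r = Part.some eqC := by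
    simp only [self, eval_ap, hr, eval_var_succ, eval_var_zero, Part.bind_some,
      app_lamC_lam_self]
    rfl
  have ha : (Tm.var 1).eval r = Part.some a := by rw [hr, eval_var_succ, eval_var_zero]
  have hb : (Tm.var 0).eval r = Part.some b := by rw [hr, eval_var_zero]
  obtain ⟨s, hs, hs'⟩ := eval_subTm hz ha hb
  have h (x : ℕ) : ∃ s, (subTm 3 1 2).eval (Nat.pair r x) = Part.some s ∧ IsSubsetType s b a := by
    apply eval_subTm
    · rw [← hz]
      simp only [self, eval_ap, eval_var_succ]
    · rw [eval_var_succ, hb]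
    · rw [eval_var_succ, ha]
  choose s' h₁ h₂ using h
  refine ⟨s, closure (subTm 3 1 2) r, s', ?_, hs', fun x => ⟨by rw [app_closure, h₁], h₂ x⟩⟩
  rw [eqType, show eqC = recLam T from rfl, app_recLam, hT, eval_lam, Part.bind_some, app_closure,
    ← hT, ← hr]
  simp only [Tm.sigma, eval_pr, eval_cst, hs, eval_lam, Part.bind_some]
  rfl

/-! ## Names of hereditarily finite sets -/

/-- `a` is a name, with finite types throughout, of the set `A`. -/
inductive Names : ℕ → ZFSet.{0} → Prop
  | mk (n e : ℕ) (f : ℕ → ℕ) (F : ℕ → ZFSet.{0}) (A : ZFSet.{0}) (hf : ∀ k < n, f k ∈ app e k)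
      (hF : ∀ k < n, Names (f k) (F k)) (hA : ∀ x, x ∈ A ↔ ∃ k < n, x = F k) :
      Names (pr (finC n) e) A

section Names

variable {X : Set ℕ}

theorem IsSubsetType.derivable {s n e m e' : ℕ} {f f' : ℕ → ℕ}
    (hs : IsSubsetType s (pr (finC n) e) (pr (finC m) e'))
    (hf : ∀ k < n, f k ∈ app e k) (hf' : ∀ k < m, f' k ∈ app e' k)
    (h : ∀ k < n, ∀ l < m, ∃ c ∈ eqType (f k) (f' l), Derivable X (.type c)) :
    Derivable X (.type s) := by
  obtain ⟨c, g, rfl, h₁, h₂⟩ := hs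
  simp only [pr0_pr, pr1_pr] at h₁ h₂ ⊢
  refine (decided_finC n).pi_type fun k hk => ⟨_, by rw [h₁]; exact Part.mem_some _, ?_⟩
  refine (decided_finC m).sigma_type fun l hl => ?_
  rw [El_finC] at hk hl
  rw [h₂ k l _ _ (hf k hk) (hf' l hl)]
  exact h k hk l hl

theorem IsSubsetType.elim {s n e m e' d : ℕ} {f f' : ℕ → ℕ}
    (hs : IsSubsetType s (pr (finC n) e) (pr (finC m) e'))
    (hf : ∀ k < n, f k ∈ app e k) (hf' : ∀ k < m, f' k ∈ app e' k) (hd : El X d s)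
    {k : ℕ} (hk : k < n) : ∃ l < m, ∃ u, ∃ c ∈ eqType (f k) (f' l), El X u c := by
  obtain ⟨c, g, rfl, h₁, h₂⟩ := hs
  simp only [pr0_pr, pr1_pr] at h₁ h₂ hd
  obtain ⟨v, -, c, hc, hv⟩ := pi_elim hd (not_nmem_finC hk)
  rw [h₁, Part.mem_some_iff] at hc
  obtain ⟨hl, c', hc', hu⟩ := sigma_elim (hc ▸ hv)
  rw [El_finC] at hl
  rw [h₂ k _ _ _ (hf k hk) (hf' _ hl)] at hc'
  exact ⟨_, hl, _, c', hc', hu⟩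

theorem IsSubsetType.refl {s n e : ℕ} {f : ℕ → ℕ}
    (hs : IsSubsetType s (pr (finC n) e) (pr (finC n) e)) (ht : Derivable X (.type s))
    (hf : ∀ k < n, f k ∈ app e k)
    (hr : ∀ k < n, ∀ l < n, ∃ c ∈ eqType (f k) (f l), Derivable X (.type c))
    (h : ∀ k < n, RealizesEq X iotaR (f k) (f k)) : El X deltaR s := by
  obtain ⟨c, g, rfl, h₁, h₂⟩ := hs
  simp only [pr0_pr, pr1_pr] at h₁ h₂ ht ⊢
  refine (decided_finC n).pi_mem ht fun k hk => ?_
  rw [El_finC] at hk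
  refine ⟨pr k iotaR, by rw [app_deltaR]; exact Part.mem_some _, sigmaC (finC n) (g k),
    by rw [h₁]; exact Part.mem_some _, ?_⟩
  obtain ⟨c', hc', hu⟩ := h k hk
  refine Derivable.sigma_mem (finC n) (g k) k iotaR c'
    ((decided_finC n).sigma_type fun l hl => ?_) ?_ (El_finC.2 hk) hu
  · rw [El_finC] at hl
    rw [h₂ k l _ _ (hf k hk) (hf l hl)]
    exact hr k hk l hl
  · rwa [h₂ k k _ _ (hf k hk) (hf k hk)]

/-- The type of `a = b` also contains the equations with sides exchanged, from `b ⊆ a`. Induction on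
`a` alone therefore has to carry both orders, with `b` arbitrary. -/
theorem exists_eqType_derivable {a : ℕ} {A : ZFSet} (ha : Names a A) :
    ∀ {b : ℕ} {B : ZFSet}, Names b B → (∃ c ∈ eqType a b, Derivable X (.type c)) ∧
      ∃ c ∈ eqType b a, Derivable X (.type c) := by
  induction ha with
  | mk n e f F A hf hF hA ih =>
    intro b B hb
    obtain ⟨m, e', f', F', -, hf', hF', -⟩ := hb
    have h₁ : ∀ k < n, ∀ l < m, ∃ c ∈ eqType (f k) (f' l), Derivable X (.type c) :=
      fun k hk l hl => (ih k hk (hF' l hl)).1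
    have h₂ : ∀ l < m, ∀ k < n, ∃ c ∈ eqType (f' l) (f k), Derivable X (.type c) :=
      fun l hl k hk => (ih k hk (hF' l hl)).2
    constructor
    · obtain ⟨s, d, s', hs, h, h'⟩ := exists_eqType (pr (finC n) e) (pr (finC m) e')
      rw [hs]
      -- The second inclusion is a type for every value of the dummy variable, so `D` can be
      -- everything and nothing about non-elements of `s` is needed.
      refine ⟨_, Part.mem_some _, .sigma_type s d Set.univ s' (h.derivable hf hf' h₁)
        (fun k hk => absurd (Set.mem_univ k) hk) (fun k _ => by rw [(h' k).1]; exact Part.mem_some _)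
        fun k _ => (h' k).2.derivable hf' hf h₂⟩
    · obtain ⟨s, d, s', hs, h, h'⟩ := exists_eqType (pr (finC m) e') (pr (finC n) e)
      rw [hs]
      refine ⟨_, Part.mem_some _, .sigma_type s d Set.univ s' (h.derivable hf' hf h₂)
        (fun k hk => absurd (Set.mem_univ k) hk) (fun k _ => by rw [(h' k).1]; exact Part.mem_some _)
        fun k _ => (h' k).2.derivable hf hf' h₁⟩

/-- The realiser `ι = 𝐩 δ δ` matches each index `k` with itself, since `δ k = 𝐩 k ι` and `ι` works
for the `k`-th member by induction. -/
theorem Names.realizesEq_refl {a : ℕ} {A : ZFSet} (ha : Names a A) : RealizesEq X iotaR a a := by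
  have ha' := ha
  induction ha with
  | mk n e f F A hf hF hA ih =>
    obtain ⟨s, d, s', hs, h, h'⟩ := exists_eqType (pr (finC n) e) (pr (finC n) e)
    have hr : ∀ k < n, ∀ l < n, ∃ c ∈ eqType (f k) (f l), Derivable X (.type c) :=
      fun k hk l hl => (exists_eqType_derivable (hF k hk) (hF l hl)).1
    have hi : ∀ k < n, RealizesEq X iotaR (f k) (f k) := fun k hk => ih k hk (hF k hk)
    obtain ⟨c, hc, ht⟩ := (exists_eqType_derivable (X := X) ha' ha').1
    rw [hs, Part.mem_some_iff] at hc
    refine ⟨c, by rw [hc]; exact Part.eq_some_iff.1 hs, ?_⟩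
    rw [hc] at ht ⊢
    refine .sigma_mem s d deltaR deltaR (s' deltaR) ht (by rw [(h' _).1]; exact Part.mem_some _)
      (h.refl (h.derivable hf hf hr) hf hr hi) ((h' _).2.refl ((h' _).2.derivable hf hf hr) hf hr hi)

/-- Extensionality by induction on `a`: the two halves of a realiser send each index of one side to
an index of the other with a realised equation. Both orders are again treated together. -/
theorem Names.eq_of_realizes {a : ℕ} {A : ZFSet} (ha : Names a A) :
    ∀ {b : ℕ} {B : ZFSet} {d : ℕ}, Names b B → (RealizesEq X d a b → A = B) ∧
      (RealizesEq X d b a → A = B) := by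
  induction ha with
  | mk n e f F A hf hF hA ih =>
    intro b B d hb
    obtain ⟨m, e', f', F', _, hf', hF', hB⟩ := hb
    have key (h₁ : ∀ k < n, ∃ l < m, F k = F' l) (h₂ : ∀ l < m, ∃ k < n, F k = F' l) : A = B := by
      ext x
      rw [hA, hB]
      constructor
      · rintro ⟨k, hk, rfl⟩
        exact h₁ k hk
      · rintro ⟨l, hl, rfl⟩
        obtain ⟨k, hk, h⟩ := h₂ l hl
        exact ⟨k, hk, h.symm⟩
    constructor
    · rintro ⟨c, hc, hd⟩
      obtain ⟨s, d', s', hs, h, h'⟩ := exists_eqType (pr (finC n) e) (pr (finC m) e')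
      change c ∈ eqType _ _ at hc
      rw [hs, Part.mem_some_iff] at hc
      obtain ⟨hd₀, c', hc', hd₁⟩ := sigma_elim (hc ▸ hd)
      rw [(h' _).1, Part.mem_some_iff] at hc'
      subst hc'
      refine key (fun k hk => ?_) fun l hl => ?_
      · obtain ⟨l, hl, u, hu⟩ := h.elim hf hf' hd₀ hk
        exact ⟨l, hl, (ih k hk (hF' l hl)).1 hu⟩
      · obtain ⟨k, hk, u, hu⟩ := (h' _).2.elim hf' hf hd₁ hl
        exact ⟨k, hk, (ih k hk (hF' l hl)).2 hu⟩
    · rintro ⟨c, hc, hd⟩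
      obtain ⟨s, d', s', hs, h, h'⟩ := exists_eqType (pr (finC m) e') (pr (finC n) e)
      change c ∈ eqType _ _ at hc
      rw [hs, Part.mem_some_iff] at hc
      obtain ⟨hd₀, c', hc', hd₁⟩ := sigma_elim (hc ▸ hd)
      rw [(h' _).1, Part.mem_some_iff] at hc'
      subst hc'
      refine key (fun k hk => ?_) fun l hl => ?_
      · obtain ⟨l, hl, u, hu⟩ := (h' _).2.elim hf hf' hd₁ hk
        exact ⟨l, hl, (ih k hk (hF' l hl)).1 hu⟩
      · obtain ⟨k, hk, u, hu⟩ := h.elim hf' hf hd₀ hl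
        exact ⟨k, hk, (ih k hk (hF' l hl)).2 hu⟩

end Names

/-- Write `n = m * m + r` with `m = n.sqrt` and `r ≤ 2 * m`. One coordinate is `m` and the other is
`r` or `2 * m - r`, according to whether `r < m`. -/
theorem pr_pr0_pr1 (n : ℕ) : pr (pr0 n) (pr1 n) = n := by
  have h₁ := Nat.sqrt_le n
  have h₂ := Nat.sqrt_le_add n
  have e (m : ℕ) : m * (m + 1) = m * m + m := by ring
  unfold pr pr0 pr1
  rw [e]
  generalize n.sqrt = m at *
  obtain ⟨r, rfl⟩ := Nat.exists_eq_add_of_le h₁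
  rw [Nat.add_sub_cancel_left]
  by_cases hr : r < m
  · have hmax₁ : max m r = m := max_eq_left hr.le
    have hmax₂ : max r m = m := max_eq_right hr.le
    by_cases hm : m % 2 = 0 <;> simp only [hm, hr, if_true, if_false, hmax₁, hmax₂] <;> omega
  · have hr' : 2 * m - r ≤ m := by omega
    have hmax₁ : max m (2 * m - r) = m := max_eq_left hr'
    have hmax₂ : max (2 * m - r) m = m := max_eq_right hr'
    by_cases hm : m % 2 = 0 <;> simp only [hm, hr, if_true, if_false, hmax₁, hmax₂] <;> omega

/-! ## Numerals and ordered pairs -/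

/-- The von Neumann numeral `n`. -/
def numZ : ℕ → ZFSet.{0}
  | 0 => ∅
  | n + 1 => insert (numZ n) (numZ n)

theorem mem_numZ {x : ZFSet} {n : ℕ} : x ∈ numZ n ↔ ∃ k < n, x = numZ k := by
  induction n with
  | zero => simp [numZ]
  | succ n ih =>
    rw [numZ, ZFSet.mem_insert_iff, ih]
    constructor
    · rintro (rfl | ⟨k, hk, rfl⟩)
      exacts [⟨n, n.lt_succ_self, rfl⟩, ⟨k, hk.trans n.lt_succ_self, rfl⟩]
    · rintro ⟨k, hk, rfl⟩
      rcases Nat.lt_succ_iff_lt_or_eq.1 hk with h | rfl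
      exacts [.inr ⟨k, h, rfl⟩, .inl rfl]

theorem numZ_injective : Function.Injective numZ := by
  intro m n h
  by_contra hne
  rcases Nat.lt_or_gt_of_ne hne with hlt | hlt
  · exact ZFSet.mem_irrefl (numZ n) (mem_numZ.2 ⟨m, hlt, h.symm⟩)
  · exact ZFSet.mem_irrefl (numZ m) (mem_numZ.2 ⟨n, hlt, h⟩)

theorem mem_app_numC (n : ℕ) : numV n ∈ app numC n := by
  rw [app_numC]
  exact Part.mem_some _

theorem names_numV (n : ℕ) : Names (numV n) (numZ n) := by
  induction n using Nat.strong_induction_on with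
  | h n ih => exact .mk n numC numV numZ _ (fun k _ => mem_app_numC k) ih fun x => mem_numZ

/-- The value of `{a, b}^V`. -/
noncomputable def upairV (a b : ℕ) : ℕ :=
  pr (finC 2) (closure (.dec (.var 2) (.var 1) (.var 0) (.cst 0)) (Nat.pair (Nat.pair 0 a) b))

/-- The value of `⟨a, b⟩^V`. -/
noncomputable def opairV (a b : ℕ) : ℕ := upairV (upairV a a) (upairV a b)

theorem eval_upair {t u : Tm} {r a b : ℕ} (ht : t.eval r = Part.some a)
    (hu : u.eval r = Part.some b) : (Tm.upair t u).eval r = Part.some (upairV a b) := by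
  simp only [Tm.upair, eval_ap, eval_cst, ht, hu, Part.bind_some, upairC, app_lamC, eval_lam,
    app_closure, eval_pr]
  rfl

theorem eval_opair {t u : Tm} {r a b : ℕ} (ht : t.eval r = Part.some a)
    (hu : u.eval r = Part.some b) : (Tm.opair t u).eval r = Part.some (opairV a b) :=
  eval_upair (eval_upair ht ht) (eval_upair ht hu)

theorem app_upairV (a b k : ℕ) :
    app (pr1 (upairV a b)) k = Part.some (if k = 0 then a else b) := by
  have h₁ : (Tm.var 1).eval (Nat.pair (Nat.pair (Nat.pair 0 a) b) k) = Part.some b := by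
    rw [eval_var_succ, eval_var_zero]
  have h₂ : (Tm.var 2).eval (Nat.pair (Nat.pair (Nat.pair 0 a) b) k) = Part.some a := by
    rw [eval_var_succ, eval_var_succ, eval_var_zero]
  simp only [upairV, pr1_pr, app_closure, eval_dec, h₁, h₂, eval_var_zero, eval_cst,
    Part.bind_some, dec]

theorem mem_app_upairV (a b k : ℕ) : (if k = 0 then a else b) ∈ app (pr1 (upairV a b)) k := by
  rw [app_upairV]
  exact Part.mem_some _

theorem Names.upair {a b : ℕ} {A B : ZFSet} (ha : Names a A) (hb : Names b B) :
    Names (upairV a b) {A, B} := by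
  refine .mk 2 _ (fun k => if k = 0 then a else b) (fun k => if k = 0 then A else B) _
    (fun k _ => by simpa only [upairV, pr1_pr] using mem_app_upairV a b k) (fun k _ => ?_)
    fun x => ?_
  · split_ifs <;> assumption
  · rw [ZFSet.mem_pair]
    constructor
    · rintro (rfl | rfl)
      exacts [⟨0, by simp⟩, ⟨1, by simp⟩]
    · rintro ⟨k, -, rfl⟩
      split_ifs <;> simp

theorem Names.opair {a b : ℕ} {A B : ZFSet} (ha : Names a A) (hb : Names b B) :
    Names (opairV a b) (ZFSet.pair A B) := by
  have h := (ha.upair ha).upair (ha.upair hb)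
  rwa [ZFSet.pair_eq_singleton] at h

theorem app_pairV (x : ℕ) : app (pr1 pairV) x =
    Part.some (opairV (opairV (numV (pr0 x)) (numV (pr1 x))) (numV x)) := by
  rw [pairV, pr1_pr, app_lamC]
  refine eval_opair (eval_opair ?_ ?_) ?_ <;>
    simp only [eval_ap, eval_cst, eval_pr0, eval_pr1, eval_var_zero, Part.bind_some, app_numC]

/-! ## Realised formulas are true of the named sets -/

section Sound

variable {X : Set ℕ}

theorem Names.mem_of_realizes {a b d : ℕ} {A B : ZFSet} (ha : Names a A) (hb : Names b B)
    (h : Realizes X (.mem a b) d) : A ∈ B := by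
  obtain ⟨n, e, f, F, _, hf, hF, hB⟩ := hb
  obtain ⟨hk, c, hc, he⟩ := h
  simp only [pr0_pr, pr1_pr, El_finC] at hk hc
  rw [Part.mem_unique hc (hf _ hk)] at he
  exact (hB A).2 ⟨_, hk, (ha.eq_of_realizes (hF _ hk)).1 he⟩

theorem Names.ball_elim {a d : ℕ} {A x : ZFSet} {φ : ℕ → Fml} (ha : Names a A)
    (h : Realizes X (.ball a φ) d) (hx : x ∈ A) : ∃ c, Names c x ∧ ∃ v, Realizes X (φ c) v := by
  obtain ⟨n, e, f, F, _, hf, hF, hA⟩ := ha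
  obtain ⟨k, hk, rfl⟩ := (hA x).1 hx
  obtain ⟨v, -, c, hc, hv⟩ := h k (by rw [pr0_pr]; exact El_finC.2 hk)
  rw [pr1_pr] at hc
  rw [Part.mem_unique hc (hf _ hk)] at hv
  exact ⟨_, hF k hk, v, hv⟩

theorem Names.bex_elim {a d : ℕ} {A : ZFSet} {φ : ℕ → Fml} (ha : Names a A)
    (h : Realizes X (.bex a φ) d) : ∃ x ∈ A, ∃ c, Names c x ∧ ∃ v, Realizes X (φ c) v := by
  obtain ⟨n, e, f, F, _, hf, hF, hA⟩ := ha
  obtain ⟨hk, c, hc, hv⟩ := h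
  simp only [pr0_pr, pr1_pr, El_finC] at hk hc
  rw [Part.mem_unique hc (hf _ hk)] at hv
  exact ⟨_, (hA _).2 ⟨_, hk, rfl⟩, _, hF _ hk, _, hv⟩

theorem eq_of_realizes_isUPair {w a b d : ℕ} {W A B : ZFSet} (hw : Names w W) (ha : Names a A)
    (hb : Names b B) (h : Realizes X (.isUPair w a b) d) : W = {A, B} := by
  obtain ⟨h₁, h₂, h₃⟩ := h
  ext x
  rw [ZFSet.mem_pair]
  constructor
  · intro hx
    obtain ⟨c, hc, v, ⟨-, hv⟩ | ⟨-, hv⟩⟩ := hw.ball_elim h₃ hx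
    exacts [.inl ((hc.eq_of_realizes ha).1 hv), .inr ((hc.eq_of_realizes hb).1 hv)]
  · rintro (rfl | rfl)
    exacts [ha.mem_of_realizes hw h₁, hb.mem_of_realizes hw h₂]

theorem eq_of_realizes_isOPair {x a b d : ℕ} {Z A B : ZFSet} (hx : Names x Z) (ha : Names a A)
    (hb : Names b B) (h : Realizes X (.isOPair x a b) d) : Z = ZFSet.pair A B := by
  obtain ⟨h₁, h₂, h₃⟩ := h
  ext y
  rw [ZFSet.pair, ZFSet.mem_pair]
  constructor
  · intro hy
    obtain ⟨c, hc, v, ⟨-, hv⟩ | ⟨-, hv⟩⟩ := hx.ball_elim h₃ hy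
    exacts [.inl (by rw [eq_of_realizes_isUPair hc ha ha hv, ZFSet.pair_eq_singleton]), .inr (eq_of_realizes_isUPair hc ha hb hv)]
  · rintro (rfl | rfl)
    · obtain ⟨y, hy, c, hc, v, hv⟩ := hx.bex_elim h₁
      rwa [eq_of_realizes_isUPair hc ha ha hv, ZFSet.pair_eq_singleton] at hy
    · obtain ⟨y, hy, c, hc, v, hv⟩ := hx.bex_elim h₂
      rwa [eq_of_realizes_isUPair hc ha hb hv] at hy

/-- The witness `u` comes with a set that it names, and the formula determines this set as the pair
of `A` and `B`. -/
theorem eq_of_realizes_isOTriple {x a b c d : ℕ} {Z A B C : ZFSet} (hx : Names x Z)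
    (ha : Names a A) (hb : Names b B) (hc : Names c C) (h : Realizes X (.isOTriple x a b c) d) :
    Z = ZFSet.pair (ZFSet.pair A B) C := by
  obtain ⟨W, -, w, hw, v, hv⟩ := hx.bex_elim h
  obtain ⟨P, -, u, hu, v', h₁, h₂⟩ := hw.bex_elim hv
  rw [eq_of_realizes_isOPair hx hu hc h₂, eq_of_realizes_isOPair hu ha hb h₁]

end Sound

/-! ## Realisers for pairs -/

/-- A realiser of `{a, b}^V = {a, b}`. -/
noncomputable def upairR : ℕ := pr (pr 0 iotaR) (pr (pr 1 iotaR) deltaR)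

/-- A realiser of `⟨a, b⟩^V = ⟨a, b⟩`. -/
noncomputable def opairR : ℕ :=
  pr (pr 0 upairR) (pr (pr 1 upairR) (lamC (.pr (.var 0) (.cst upairR))))

/-- A realiser of `⟨⟨a, b⟩^V, c⟩^V = ⟨⟨a, b⟩, c⟩`. -/
noncomputable def otripleR : ℕ := pr 0 (pr 0 (pr opairR opairR))

section Realizers

variable {X : Set ℕ}

theorem realizes_mem {a b k c : ℕ} {A : ZFSet} (ha : Names a A) (hk : El X k (pr0 b))
    (hc : c ∈ app (pr1 b) k) (h : a = c) : Realizes X (.mem a b) (pr k iotaR) := by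
  subst h
  refine ⟨by rwa [pr0_pr], a, by rwa [pr0_pr], ?_⟩
  rw [pr1_pr]
  exact ha.realizesEq_refl

theorem realizes_bex {a k c v : ℕ} {φ : ℕ → Fml} (hk : El X k (pr0 a)) (hc : c ∈ app (pr1 a) k)
    (h : Realizes X (φ c) v) : Realizes X (.bex a φ) (pr k v) := by
  refine ⟨by rwa [pr0_pr], c, by rwa [pr0_pr], ?_⟩
  rwa [pr1_pr]

theorem realizes_and {φ ψ : Fml} {u v : ℕ} (hu : Realizes X φ u) (hv : Realizes X ψ v) :
    Realizes X (.and φ ψ) (pr u v) :=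
  ⟨by rwa [pr0_pr], by rwa [pr1_pr]⟩

theorem El_upairV {a b k : ℕ} : El X k (pr0 (upairV a b)) ↔ k < 2 := by
  rw [upairV, pr0_pr, El_finC]

theorem realizes_isUPair {a b : ℕ} {A B : ZFSet} (ha : Names a A) (hb : Names b B) :
    Realizes X (.isUPair (upairV a b) a b) upairR := by
  refine realizes_and (realizes_mem ha (El_upairV.2 (by simp)) (mem_app_upairV a b 0) rfl)
    (realizes_and (realizes_mem hb (El_upairV.2 (by simp)) (mem_app_upairV a b 1) rfl) ?_)
  intro k hk
  refine ⟨pr k iotaR, by rw [app_deltaR]; exact Part.mem_some _, _, mem_app_upairV a b k, ?_⟩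
  rw [El_upairV] at hk
  interval_cases k
  · exact .inl ⟨pr0_pr _ _, by rw [pr1_pr]; exact ha.realizesEq_refl⟩
  · exact .inr ⟨pr0_pr _ _, by rw [pr1_pr]; exact hb.realizesEq_refl⟩

theorem realizes_isOPair {a b : ℕ} {A B : ZFSet} (ha : Names a A) (hb : Names b B) :
    Realizes X (.isOPair (opairV a b) a b) opairR := by
  refine realizes_and (realizes_bex (El_upairV.2 (by simp)) (mem_app_upairV _ _ 0)
    (realizes_isUPair ha ha)) (realizes_and (realizes_bex (El_upairV.2 (by simp))
      (mem_app_upairV _ _ 1) (realizes_isUPair ha hb)) ?_)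
  intro k hk
  refine ⟨pr k upairR, ?_, _, mem_app_upairV _ _ k, ?_⟩
  · simp only [app_lamC, eval_pr, eval_var_zero, eval_cst, Part.bind_some, Part.mem_some_iff]
  have hk' := El_upairV.1 hk
  interval_cases k
  · exact .inl ⟨pr0_pr _ _, by rw [pr1_pr]; exact realizes_isUPair ha ha⟩
  · exact .inr ⟨pr0_pr _ _, by rw [pr1_pr]; exact realizes_isUPair ha hb⟩

theorem realizes_isOTriple {a b c : ℕ} {A B C : ZFSet} (ha : Names a A) (hb : Names b B)
    (hc : Names c C) :
    Realizes X (.isOTriple (opairV (opairV a b) c) a b c) otripleR :=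
  realizes_bex (El_upairV.2 (by simp)) (mem_app_upairV _ _ 0)
    (realizes_bex (El_upairV.2 (by simp)) (mem_app_upairV _ _ 0)
      (realizes_and (realizes_isOPair ha hb) (realizes_isOPair (ha.opair hb) hc)))

end Realizers

/-! ## The formula `p(i, k) ∈ α₀` -/

namespace SeqCoding

variable (c : SeqCoding) {h : ℕ → ℕ}

theorem length_initSeg (h : ℕ → ℕ) (l : ℕ) : (initSeg h l).length = l := by simp [initSeg]

theorem take_initSeg (h : ℕ → ℕ) {l m : ℕ} (hm : m ≤ l) : (initSeg h l).take m = initSeg h m := by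
  rw [initSeg, ← List.map_take, List.take_range, min_eq_left hm, initSeg]

theorem app_len (h : ℕ → ℕ) (l : ℕ) : app c.len (c.code (initSeg h l)) = Part.some l := by
  rw [c.len_spec, length_initSeg]

theorem app_trunc (h : ℕ → ℕ) {l m : ℕ} (hm : m ≤ l) :
    ((app c.trunc (c.code (initSeg h l))).bind fun q => app q m) =
      Part.some (c.code (initSeg h m)) := by
  rw [c.trunc_spec _ _ (by rwa [length_initSeg]), take_initSeg h hm]

theorem app_alphaV (h : ℕ → ℕ) (l : ℕ) :
    app (pr1 c.alphaV) (c.code (initSeg h l)) = Part.some (numV l) := by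
  simp only [alphaV, pr1_pr, app_lamC, eval_ap, eval_cst, eval_var_zero, Part.bind_some, app_len,
    app_numC]

theorem El_alphaV {X : Set ℕ} {t : ℕ} : El X t (pr0 c.alphaV) ↔ t ∈ X := by
  rw [alphaV, pr0_pr, El_xC]

theorem realizes_pairMem (h : ℕ → ℕ) (i k : ℕ) :
    Realizes (c.segs h) (c.pairMem (numV i) (numV k))
      (pr (pr i k) (pr (c.code (initSeg h (pr i k))) otripleR)) := by
  refine realizes_bex (c := opairV (opairV (numV i) (numV k)) (numV (pr i k))) ?_ ?_
    (realizes_bex (c := numV (pr i k)) ?_ ?_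
      (realizes_isOTriple (names_numV i) (names_numV k) (names_numV _)))
  · rw [pairV, pr0_pr]
    exact El_natC _
  · rw [app_pairV, pr0_pr, pr1_pr]
    exact Part.mem_some _
  · exact c.El_alphaV.2 ⟨_, rfl⟩
  · rw [app_alphaV]
    exact Part.mem_some _

/-- The index `x` chosen in the pairing function names `⟨⟨𝐩₀ x, 𝐩₁ x⟩, x⟩`, and the index chosen in
`α₀` codes a segment of some length `l`. Soundness gives `𝐩₀ x = i`, `𝐩₁ x = k` and `x = l`, so `l =
𝐩 i k`. -/
theorem eq_of_realizes_pairMem {i k d : ℕ}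
    (hd : Realizes (c.segs h) (c.pairMem (numV i) (numV k)) d) :
    pr0 (pr1 d) = c.code (initSeg h (pr i k)) := by
  obtain ⟨-, x, hx, ht, m, hm, hr⟩ := hd
  obtain ⟨l, hl⟩ := c.El_alphaV.1 ht
  rw [app_pairV, Part.mem_some_iff] at hx
  rw [hl, app_alphaV, Part.mem_some_iff] at hm
  subst hx hm
  have h₁ := eq_of_realizes_isOTriple (((names_numV _).opair (names_numV _)).opair (names_numV _))
    (names_numV i) (names_numV k) (names_numV l) hr
  rw [ZFSet.pair_inj, ZFSet.pair_inj] at h₁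
  obtain ⟨⟨hi, hk⟩, hp⟩ := h₁
  rw [← numZ_injective hi, ← numZ_injective hk, pr_pr0_pr1, numZ_injective hp, hl]

end SeqCoding

/-! ### Membership and bounded quantification for numerals and `ω` -/

theorem numV_mem_V {X : Set ℕ} (n : ℕ) : numV n ∈ V X := by
  induction n using Nat.strong_induction_on with
  | h n ih =>
    exact (decided_finC n).set fun k hk => ⟨numV k, mem_app_numC k, ih k (El_finC.1 hk)⟩

theorem El_numV {X : Set ℕ} {k n : ℕ} : El X k (pr0 (numV n)) ↔ k < n := by
  rw [numV, pr0_pr, El_finC]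

theorem mem_app_numV (n k : ℕ) : numV k ∈ app (pr1 (numV n)) k := by
  rw [numV, pr1_pr]
  exact mem_app_numC k

theorem mem_app_omegaV (k : ℕ) : numV k ∈ app (pr1 omegaV) k := by
  rw [omegaV, pr1_pr]
  exact mem_app_numC k

theorem realizes_mem_omegaV {X : Set ℕ} (n : ℕ) :
    Realizes X (.mem (numV n) omegaV) (pr n iotaR) :=
  realizes_mem (names_numV n) (by rw [omegaV, pr0_pr]; exact El_natC n) (mem_app_omegaV n) rfl

theorem realizes_mem_numV {X : Set ℕ} {k n : ℕ} (hk : k < n) :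
    Realizes X (.mem (numV k) (numV n)) (pr k iotaR) :=
  realizes_mem (names_numV k) (El_numV.2 hk) (mem_app_numV n k) rfl

theorem realizes_ball_numV {X : Set ℕ} {n d : ℕ} {φ : ℕ → Fml} :
    Realizes X (.ball (numV n) φ) d ↔ ∀ k < n, ∃ v ∈ app d k, Realizes X (φ (numV k)) v := by
  constructor
  · intro h k hk
    obtain ⟨v, hv, c, hc, hr⟩ := h k (El_numV.2 hk)
    rw [Part.mem_unique hc (mem_app_numV n k)] at hr
    exact ⟨v, hv, hr⟩
  · intro h k hk
    obtain ⟨v, hv, hr⟩ := h k (El_numV.1 hk)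
    exact ⟨v, hv, _, mem_app_numV n k, hr⟩

theorem realizes_ball_omegaV {X : Set ℕ} {d : ℕ} {φ : ℕ → Fml}
    (h : ∀ n, ∃ v ∈ app d n, Realizes X (φ (numV n)) v) : Realizes X (.ball omegaV φ) d := by
  intro n _
  obtain ⟨v, hv, hr⟩ := h n
  exact ⟨v, hv, _, mem_app_omegaV n, hr⟩

namespace SeqCoding

variable (c : SeqCoding)

/-! ## Strong incomparability -/

section Incomparable

variable {h : ℕ → ℕ}

theorem realizes_memF {n i g : ℕ} (hg : ∀ k < n, ∃ v ∈ app g k,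
    Realizes (c.segs h) (c.pairMem (numV i) (numV k)) v) :
    Realizes (c.segs h) (c.memF (numV n) (numV i)) (pr (pr n iotaR) g) :=
  realizes_and (realizes_mem_omegaV n) (realizes_ball_numV.2 hg)

/-- For `k < n` the maximum of `i` and `k` is below `n`, and `Nat.sqrt` recovers the maximum from
the pair. -/
theorem pr_le_pr {i k n : ℕ} (hi : i < n) (hk : k ≤ n) : pr i k ≤ pr i n := by
  rcases hk.eq_or_lt with rfl | hk
  · exact le_rfl
  · by_contra hlt
    have := Nat.sqrt_le_sqrt (not_le.1 hlt).le
    rw [sqrt_pr, sqrt_pr] at this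
    omega

theorem exists_program {i j d : ℕ}
    (hd : Realizes (c.segs h) (c.subF (numV i) (numV j)) d) :
    ∃ f, ∀ n, i < n →
      c.code (initSeg h (pr j n)) ∈ app f (c.code (initSeg h (pr i n))) := by
  obtain ⟨sc, hsc⟩ := exists_code_of_primrec Primrec.succ
  have hs (n : ℕ) : app (Encodable.encode sc) n = Part.some (n + 1) := by
    rw [app, Denumerable.ofNat_encode, hsc]
  -- The input `t` has length `𝐩 i n`, so `tn` recovers `n`. The set used is `n + 1` (`tn'`), so
  -- that `n` itself is among its elements. `tg` truncates `t` to length `𝐩 i k`, and `tr` realises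
  -- `n + 1 ∈ f₀(i)`.
  let tn : Tm := .pr1 (.ap (.cst c.len) (.var 0))
  let tn' : Tm := .ap (.cst (Encodable.encode sc)) tn
  let tg : Tm := .pr (.pr (.cst i) (.var 0))
    (.pr (.ap (.ap (.cst c.trunc) (.var 1)) (.pr (.cst i) (.var 0))) (.cst otripleR))
  let tr : Tm := .pr (.pr tn' (.cst iotaR)) (.lam tg)
  refine ⟨lamC (.pr0 (.pr1 (.ap (.pr1 (.ap (.ap (.cst d) (.ap (.cst numC) tn')) tr)) tn))),
    fun n hn => ?_⟩
  set t := c.code (initSeg h (pr i n)) with ht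
  have e₁ : tn.eval (Nat.pair 0 t) = Part.some n := by
    simp only [tn, eval_pr1, eval_ap, eval_cst, eval_var_zero, Part.bind_some, ht, app_len, pr1_pr]
  have e₂ : tn'.eval (Nat.pair 0 t) = Part.some (n + 1) := by
    simp only [tn', eval_ap, eval_cst, e₁, Part.bind_some, hs]
  have e₃ : tr.eval (Nat.pair 0 t) =
      Part.some (pr (pr (n + 1) iotaR) (closure tg (Nat.pair 0 t))) := by
    simp only [tr, eval_pr, eval_cst, eval_lam, e₂, Part.bind_some]
  have hg : ∀ k < n + 1, ∃ v ∈ app (closure tg (Nat.pair 0 t)) k,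
      Realizes (c.segs h) (c.pairMem (numV i) (numV k)) v := by
    intro k hk
    refine ⟨_, ?_, c.realizes_pairMem h i k⟩
    have h₁ : (Tm.var 1).eval (Nat.pair (Nat.pair 0 t) k) = Part.some t := by
      rw [eval_var_succ, eval_var_zero]
    have h₂ : ((app c.trunc t).bind fun q => app q (pr i k)) =
        Part.some (c.code (initSeg h (pr i k))) := by
      exact c.app_trunc h (pr_le_pr hn (Nat.lt_succ_iff.1 hk))
    simp only [tg, app_closure, eval_pr, eval_ap, eval_cst, eval_var_zero, h₁, Part.bind_some, h₂,
      Part.mem_some_iff]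
  obtain ⟨v, hv, hv'⟩ := hd _ (numV_mem_V (n + 1))
  obtain ⟨w, hw, -, hw'⟩ := hv' _ (c.realizes_memF hg)
  obtain ⟨u, hu, hu'⟩ := realizes_ball_numV.1 hw' n n.lt_succ_self
  simp only [app_lamC, eval_pr0, eval_pr1, eval_ap, eval_cst, e₁, e₂, e₃, Part.bind_some, app_numC,
    Part.eq_some_iff.2 hv, Part.eq_some_iff.2 hw, Part.eq_some_iff.2 hu, Part.mem_some_iff]
  exact (c.eq_of_realizes_pairMem hu').symm

theorem eq_of_realizes_subF (hh : c.MeetsAll h) {i j d : ℕ}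
    (hd : Realizes (c.segs h) (c.subF (numV i) (numV j)) d) : i = j := by
  by_contra hij
  obtain ⟨f, hf⟩ := c.exists_program hd
  obtain ⟨l, n, hi, -, h₁, h₂, h₃⟩ := hh i j f hij
  rw [length_initSeg] at h₁ h₂
  rw [take_initSeg h h₁, take_initSeg h h₂] at h₃
  exact h₃ _ (hf n hi) rfl

/-- The innermost function may ignore its argument: once the inclusion has any realiser at all, `i`
and `j` coincide and `ι` realises the equation. -/
theorem realizes_incomparable (hh : c.MeetsAll h) : Realizes (c.segs h)
    (.ball omegaV fun i => .ball omegaV fun j => .imp (c.subF i j) (.eq i j))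
    (lamC (.lam (.lam (.cst iotaR)))) := by
  refine realizes_ball_omegaV fun i => ⟨_, by
    rw [app_lamC, eval_lam]; exact Part.mem_some _, realizes_ball_omegaV fun j => ⟨_, by
      rw [app_closure, eval_lam]; exact Part.mem_some _, fun d hd => ⟨iotaR, by
        rw [app_closure, eval_cst]; exact Part.mem_some _, ?_⟩⟩⟩
  rw [c.eq_of_realizes_subF hh hd]
  exact (names_numV j).realizesEq_refl

end Incomparable

/-! ## Existence of `h` -/

theorem pr_of_even {i n : ℕ} (hi : i < n) (hn : n % 2 = 0) : pr i n = n * n + 2 * n - i := by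
  rw [pr, max_eq_right hi.le, if_pos hn]
  have : n * (n + 1) = n * n + n := by ring
  omega

theorem pr_of_odd {i n : ℕ} (hi : i < n) (hn : n % 2 = 1) : pr i n = n * n + i := by
  rw [pr, max_eq_right hi.le, if_neg (by omega)]
  have : n * (n + 1) = n * n + n := by ring
  omega

/-- For fixed `n > i`, `𝐩 i n` increases with `i` when `n` is odd and decreases when `n` is even.
The parity of `n` is chosen by the order of `i` and `j`. -/
theorem exists_pr_lt_pr {i j : ℕ} (hij : i ≠ j) (N : ℕ) :
    ∃ n, i < n ∧ j < n ∧ N ≤ pr i n ∧ pr i n < pr j n := by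
  rcases Nat.lt_or_gt_of_ne hij with h | h
  · obtain ⟨n, hn, hn'⟩ : ∃ n, n = 2 * (i + j + N) + 1 ∧ n ≤ n * n :=
      ⟨_, rfl, Nat.le_mul_self _⟩
    refine ⟨n, by omega, by omega, ?_⟩
    rw [pr_of_odd (by omega) (by omega), pr_of_odd (by omega) (by omega)]
    omega
  · obtain ⟨n, hn, hn'⟩ : ∃ n, n = 2 * (i + j + N + 1) ∧ n ≤ n * n :=
      ⟨_, rfl, Nat.le_mul_self _⟩
    refine ⟨n, by omega, by omega, ?_⟩
    rw [pr_of_even (by omega) (by omega), pr_of_even (by omega) (by omega)]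
    omega

theorem exists_requirement {i j : ℕ} (hij : i ≠ j) (f : ℕ) (s : List ℕ) :
    ∃ s', s <+: s' ∧ c.Requirement i j f s' := by
  obtain ⟨n, hi, hj, hs, hlt⟩ := exists_pr_lt_pr hij s.length
  -- `s₁` is `s` padded to length `𝐩 i n`; `s₂ x` extends it to length `𝐩 j n` with the free last
  -- entry `x`.
  let s₁ := s ++ List.replicate (pr i n - s.length) 0
  let s₂ (x : ℕ) := s₁ ++ List.replicate (pr j n - pr i n - 1) 0 ++ [x]
  have l₁ : s₁.length = pr i n := by simp only [s₁, List.length_append, List.length_replicate]; omega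
  have l₂ (x : ℕ) : (s₂ x).length = pr j n := by
    simp only [s₂, List.length_append, List.length_replicate, List.length_singleton, l₁]; omega
  have t₁ (x : ℕ) : (s₂ x).take (pr i n) = s₁ := by
    simp only [s₂, List.append_assoc]
    rw [← l₁, List.take_left]
  have t₂ (x : ℕ) : (s₂ x).take (pr j n) = s₂ x := by rw [← l₂ x, List.take_length]
  have hp (x : ℕ) : s <+: s₂ x := by
    simp only [s₂, s₁, List.append_assoc]
    exact List.prefix_append _ _
  have hr (x : ℕ) (hx : ∀ v ∈ app f (c.code s₁), v ≠ c.code (s₂ x)) :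
      ∃ s', s <+: s' ∧ c.Requirement i j f s' :=
    ⟨s₂ x, hp x, n, hi, hj, by rw [l₂]; exact hlt.le, (l₂ x).ge, by rwa [t₁, t₂]⟩
  by_cases h₀ : ∀ v ∈ app f (c.code s₁), v ≠ c.code (s₂ 0)
  · exact hr 0 h₀
  · push Not at h₀
    obtain ⟨v, hv, rfl⟩ := h₀
    -- The program outputs the code of `s₂ 0`, which by injectivity of the coding is not that of `s₂
    -- 1`.
    refine hr 1 fun w hw hw' => ?_
    have := c.code_injective ((Part.mem_unique hv hw).trans hw')
    simp [s₂] at this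

theorem exists_initSeg_eq (s : ℕ → List ℕ) (hs : ∀ m, s m <+: s (m + 1))
    (hl : ∀ m, m ≤ (s m).length) : ∃ h : ℕ → ℕ, ∀ m, initSeg h (s m).length = s m := by
  have hmono {m n : ℕ} (hmn : m ≤ n) : s m <+: s n := by
    induction n, hmn using Nat.le_induction with
    | base => exact List.prefix_refl _
    | succ n _ ih => exact ih.trans (hs n)
  -- Stage `k + 1` has more than `k` entries, so the default `0` is never used.
  refine ⟨fun k => (s (k + 1)).getD k 0, fun m => List.ext_getElem (length_initSeg _ _) ?_⟩
  intro k h₁ h₂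
  have h₃ : k < (s (k + 1)).length := hl (k + 1)
  simp only [initSeg, List.getElem_map, List.getElem_range, List.getD_eq_getElem _ _ h₃]
  rcases le_total (k + 1) m with hm | hm
  · exact (hmono hm).getElem h₃
  · exact ((hmono hm).getElem h₂).symm

theorem exists_meetsAll : ∃ h, c.MeetsAll h := by
  -- Stage `m` treats the requirement coded by `m`; the appended `0` makes the lengths grow even
  -- when `m` codes none.
  have step (m : ℕ) (s : List ℕ) : ∃ s', s ++ [0] <+: s' ∧
      (m.unpair.1 ≠ m.unpair.2.unpair.1 →
        c.Requirement m.unpair.1 m.unpair.2.unpair.1 m.unpair.2.unpair.2 s') := by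
    by_cases hm : m.unpair.1 = m.unpair.2.unpair.1
    · exact ⟨_, List.prefix_refl _, fun h => absurd hm h⟩
    · obtain ⟨s', h₁, h₂⟩ := c.exists_requirement hm m.unpair.2.unpair.2 (s ++ [0])
      exact ⟨s', h₁, fun _ => h₂⟩
  choose F hF hF' using step
  let s : ℕ → List ℕ := fun m => Nat.rec [] F m
  obtain ⟨h, hh⟩ := exists_initSeg_eq s (fun m => (List.prefix_append _ _).trans (hF m (s m)))
    fun m => by
      induction m with
      | zero => exact Nat.zero_le _
      | succ m ih =>
        have := (hF m (s m)).length_le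
        rw [List.length_append, List.length_singleton] at this
        exact (Nat.succ_le_succ ih).trans this
  refine ⟨h, fun i j f hij => ⟨(s (Nat.pair i (Nat.pair j f) + 1)).length, ?_⟩⟩
  rw [hh (Nat.pair i (Nat.pair j f) + 1)]
  have := hF' (Nat.pair i (Nat.pair j f)) (s (Nat.pair i (Nat.pair j f)))
  simp only [Nat.unpair_pair] at this
  exact this hij

/-! ## The sets `f₀(i)` of the model -/

/-- In an environment with `n` and `i`: the type of the functions that assign to every `k < n` the
code of an initial segment of length `𝐩 i k`. -/
noncomputable def segTm : Tm :=
  .pi (.pr (.cst 0) (.var 0)) (.lam (.sigma (.cst xC) (.lam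
    (.pr (.cst 0) (.dec (.cst 1) (.cst 0) (.ap (.cst c.len) (.var 0)) (.pr (.var 3) (.var 1)))))))

/-- A name of the set `f₀(i)`. -/
noncomputable def nameF (i : ℕ) : ℕ :=
  pr (sigmaC natC (closure c.segTm (Nat.pair 0 i))) (lamC (.ap (.cst numC) (.pr0 (.var 0))))

theorem mem_app_nameF (i z : ℕ) : numV (pr0 z) ∈ app (pr1 (c.nameF i)) z := by
  simp only [nameF, pr1_pr, app_lamC, eval_ap, eval_cst, eval_pr0, eval_var_zero, Part.bind_some,
    app_numC, Part.mem_some_iff]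

section NameF

variable {h : ℕ → ℕ}

/-- The type of the codes of initial segments of length `𝐩 i k`. -/
theorem exists_segType (i n : ℕ) : ∃ e, ∃ g : ℕ → ℕ,
    app (closure c.segTm (Nat.pair 0 i)) n = Part.some (piC (finC n) e) ∧
    (∀ k, app e k = Part.some (sigmaC xC (g k))) ∧
    ∀ k l, app (g k) (c.code (initSeg h l)) = Part.some (finC (dec 1 0 l (pr i k))) := by
  let b : Tm := .pr (.cst 0) (.dec (.cst 1) (.cst 0) (.ap (.cst c.len) (.var 0))
    (.pr (.var 3) (.var 1)))
  refine ⟨closure (.sigma (.cst xC) (.lam b)) (Nat.pair (Nat.pair 0 i) n),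
    fun k => closure b (Nat.pair (Nat.pair (Nat.pair 0 i) n) k), ?_, fun k => ?_, fun k l => ?_⟩
  · simp only [segTm, Tm.pi, app_closure, eval_pr, eval_cst, eval_var_zero, eval_lam,
      Part.bind_some]
    rfl
  · simp only [Tm.sigma, app_closure, eval_pr, eval_cst, eval_lam, Part.bind_some]
    rfl
  · simp only [b, app_closure, eval_pr, eval_dec, eval_cst, eval_ap, eval_var_zero, eval_var_succ,
      Part.bind_some, app_len]
    rfl

/-- The length test only has to be defined on codes of segments, as all other numbers are
non-elements of `xC`. -/
theorem segType_derivable {i k g : ℕ} (hg : ∀ l, app g (c.code (initSeg h l)) =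
    Part.some (finC (dec 1 0 l (pr i k)))) : Derivable (c.segs h) (.type (sigmaC xC g)) := by
  refine decided_xC.sigma_type fun t ht => ?_
  obtain ⟨l, rfl⟩ := El_xC.1 ht
  exact ⟨_, by rw [hg]; exact Part.mem_some _, .fin_type _⟩

theorem nameF_type_derivable (i : ℕ) : Derivable (c.segs h) (.type (pr0 (c.nameF i))) := by
  rw [nameF, pr0_pr]
  refine decided_natC.sigma_type fun n _ => ?_
  obtain ⟨e, g, h₁, h₂, h₃⟩ := c.exists_segType (h := h) i n
  exact ⟨_, by rw [h₁]; exact Part.mem_some _, (decided_finC n).pi_type fun k _ =>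
    ⟨_, by rw [h₂]; exact Part.mem_some _, c.segType_derivable (h₃ k)⟩⟩

theorem nameF_mem_V (i : ℕ) : c.nameF i ∈ V (c.segs h) := by
  have h₁ := c.nameF_type_derivable (h := h) i
  have h₂ := c.mem_app_nameF i
  rw [nameF, pr0_pr] at h₁
  simp only [nameF, pr1_pr] at h₂
  exact .set _ _ Set.univ _ h₁ (fun k hk => absurd (Set.mem_univ k) hk) (fun z _ => h₂ z)
    fun z _ => numV_mem_V _

/-- The length test is expressed as a type: `finC 1`, whose only element is `0`, if the length is `𝐩
i k`, and the empty `finC 0` otherwise. Hence the second component `0`, and the segment is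
determined by its length. -/
theorem El_nameF {i z : ℕ} : El (c.segs h) z (pr0 (c.nameF i)) ↔
    ∀ k < pr0 z, pr (c.code (initSeg h (pr i k))) 0 ∈ app (pr1 z) k := by
  have ht := c.nameF_type_derivable (h := h) i
  rw [nameF, pr0_pr] at ht ⊢
  obtain ⟨e, g, h₁, h₂, h₃⟩ := c.exists_segType (h := h) i (pr0 z)
  constructor
  · intro hz k hk
    obtain ⟨-, m, hm, hz⟩ := sigma_elim hz
    rw [h₁, Part.mem_some_iff] at hm
    obtain ⟨v, hv, m', hm', hv'⟩ := pi_elim (hm ▸ hz) (not_nmem_finC hk)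
    rw [h₂, Part.mem_some_iff] at hm'
    obtain ⟨hX, m'', hm'', hv''⟩ := sigma_elim (hm' ▸ hv')
    obtain ⟨l, hl⟩ := El_xC.1 hX
    rw [hl, h₃, Part.mem_some_iff] at hm''
    rw [hm'', El_finC, dec] at hv''
    split_ifs at hv'' with hlk
    · rw [Nat.lt_one_iff] at hv''
      rwa [← hlk, ← hl, ← hv'', pr_pr0_pr1]
    · exact absurd hv'' (Nat.not_lt_zero _)
  · intro hz
    rw [← pr_pr0_pr1 z]
    refine .sigma_mem _ _ _ _ _ ht (by rw [h₁]; exact Part.mem_some _) (El_natC _) ?_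
    refine (decided_finC _).pi_mem ?_ fun k hk => ⟨_, hz k (El_finC.1 hk), _,
      by rw [h₂]; exact Part.mem_some _, ?_⟩
    · exact (decided_finC _).pi_type fun k _ =>
        ⟨_, by rw [h₂]; exact Part.mem_some _, c.segType_derivable (h₃ k)⟩
    · refine Derivable.sigma_mem _ _ _ _ _ (c.segType_derivable (h₃ k))
        (by rw [h₃]; exact Part.mem_some _) (El_xC.2 ⟨_, rfl⟩) (El_finC.2 ?_)
      simp [dec]

theorem realizes_ball_nameF {i d : ℕ} {φ : ℕ → Fml}
    (hd : ∀ z, El (c.segs h) z (pr0 (c.nameF i)) →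
      ∃ v ∈ app d z, Realizes (c.segs h) (φ (numV (pr0 z))) v) :
    Realizes (c.segs h) (.ball (c.nameF i) φ) d := by
  intro z hz
  obtain ⟨v, hv, hr⟩ := hd z hz
  exact ⟨v, hv, _, c.mem_app_nameF i z, hr⟩

theorem realizes_mem_nameF {i n g : ℕ}
    (hg : ∀ k < n, pr (c.code (initSeg h (pr i k))) 0 ∈ app g k) :
    Realizes (c.segs h) (.mem (numV n) (c.nameF i)) (pr (pr n g) iotaR) :=
  realizes_mem (names_numV n) (c.El_nameF.2 (by rwa [pr0_pr, pr1_pr])) (c.mem_app_nameF i _)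
    (by rw [pr0_pr])

/-- In an environment with an element `z` of the type of `y` and `i`: a realiser of
`∀ k ∈ n, p(i, k) ∈ α₀`, for the number `n` named by `z`. -/
noncomputable def isFBody : Tm :=
  .pr (.pr (.var 2) (.var 0)) (.pr (.pr0 (.ap (.pr1 (.var 1)) (.var 0))) (.cst otripleR))

/-- In an environment with `i`: a realiser of `∀ n ∈ y, n ∈ f₀(i)`. -/
noncomputable def isFTm : Tm :=
  .lam (.pr (.pr (.pr0 (.var 0)) (.cst iotaR)) (.lam isFBody))

theorem realizes_ball_memF (i : ℕ) : ∃ d, isFTm.eval (Nat.pair 0 i) = Part.some d ∧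
    Realizes (c.segs h) (.ball (c.nameF i) fun n => c.memF n (numV i)) d := by
  refine ⟨_, eval_lam _ _, c.realizes_ball_nameF fun z hz => ⟨_, ?_, c.realizes_memF
    (g := closure isFBody (Nat.pair (Nat.pair 0 i) z)) fun k hk =>
      ⟨_, ?_, c.realizes_pairMem h i k⟩⟩⟩
  · simp only [app_closure, eval_pr, eval_pr0, eval_cst, eval_var_zero, eval_lam, Part.bind_some]
    exact Part.mem_some _
  · simp only [isFBody, app_closure, eval_pr, eval_pr0, eval_pr1, eval_ap, eval_cst, eval_var_zero,
      eval_var_succ, Part.bind_some, Part.eq_some_iff.2 (c.El_nameF.1 hz k hk), pr0_pr,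
      Part.mem_some_iff]

/-- The index in `y` is extracted from the given realiser, which already contains the required
codes, so `d` does not depend on `i`. -/
theorem exists_realizes_isF : ∃ d, ∀ i, Realizes (c.segs h)
    (.ball omegaV fun n => .imp (.ball n fun k => c.pairMem (numV i) k) (.mem n (c.nameF i))) d := by
  let b : Tm := .pr (.pr0 (.pr1 (.ap (.var 1) (.var 0)))) (.cst 0)
  refine ⟨lamC (.lam (.pr (.pr (.var 1) (.lam b)) (.cst iotaR))), fun i => realizes_ball_omegaV fun n => ⟨_, by
      rw [app_lamC, eval_lam]; exact Part.mem_some _, fun d hd => ⟨_, ?_, c.realizes_mem_nameF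
        (g := closure b (Nat.pair (Nat.pair 0 n) d)) fun k hk => ?_⟩⟩⟩
  · simp only [app_closure, eval_pr, eval_cst, eval_var_zero, eval_var_succ, eval_lam,
      Part.bind_some]
    exact Part.mem_some _
  · obtain ⟨v, hv, hr⟩ := realizes_ball_numV.1 hd k hk
    simp only [b, app_closure, eval_pr, eval_pr0, eval_pr1, eval_ap, eval_cst, eval_var_zero,
      eval_var_succ, Part.bind_some, Part.eq_some_iff.2 hv, c.eq_of_realizes_pairMem hr,
      Part.mem_some_iff]

theorem exists_realizes_subset_omegaV : ∃ d, ∀ i,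
    Realizes (c.segs h) (.subset (c.nameF i) omegaV) d := by
  refine ⟨lamC (.pr (.pr0 (.var 0)) (.cst iotaR)), fun i => c.realizes_ball_nameF fun z _ =>
    ⟨_, ?_, realizes_mem_omegaV _⟩⟩
  simp only [app_lamC, eval_pr, eval_pr0, eval_cst, eval_var_zero, Part.bind_some,
    Part.mem_some_iff]

/-- An element `k < n` of the numeral `n` is placed in the set by the same listing function, used
only below `k`. -/
theorem exists_realizes_isTransitive : ∃ d, ∀ i,
    Realizes (c.segs h) (.isTransitive (c.nameF i)) d := by
  refine ⟨lamC (.lam (.pr (.pr (.var 0) (.pr1 (.var 1))) (.cst iotaR))), fun i =>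
    c.realizes_ball_nameF fun z hz => ⟨_, by
      rw [app_lamC, eval_lam]; exact Part.mem_some _, realizes_ball_numV.2 fun k hk =>
        ⟨_, ?_, c.realizes_mem_nameF fun l hl => c.El_nameF.1 hz l (hl.trans hk)⟩⟩⟩
  simp only [app_closure, eval_pr, eval_pr1, eval_cst, eval_var_zero, eval_var_succ,
    Part.bind_some, Part.mem_some_iff]

theorem exists_realizes_ball_isTransitive : ∃ d, ∀ i,
    Realizes (c.segs h) (.ball (c.nameF i) Fml.isTransitive) d := by
  refine ⟨lamC (.lam (.cst deltaR)), fun i => c.realizes_ball_nameF fun z _ => ⟨_, by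
    rw [app_lamC, eval_lam]; exact Part.mem_some _, realizes_ball_numV.2 fun k hk => ⟨_, by
      rw [app_closure, eval_cst]; exact Part.mem_some _, realizes_ball_numV.2 fun l hl => ⟨_, by
        rw [app_deltaR]; exact Part.mem_some _, realizes_mem_numV (hl.trans hk)⟩⟩⟩⟩

theorem exists_realizes_isOrd : ∃ e, Realizes (c.segs h)
    (.ball omegaV fun i => .ex fun y =>
      .and (c.isF y i) (.and (.subset y omegaV) (.isOrd y))) e := by
  obtain ⟨d₁, h₁⟩ := c.exists_realizes_isF (h := h)
  obtain ⟨d₂, h₂⟩ := c.exists_realizes_subset_omegaV (h := h)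
  obtain ⟨d₃, h₃⟩ := c.exists_realizes_isTransitive (h := h)
  obtain ⟨d₄, h₄⟩ := c.exists_realizes_ball_isTransitive (h := h)
  -- The first component evaluates to `c.nameF i`. Of the realisers, only the one for `∀ n ∈ y, n ∈
  -- f₀(i)` has to be computed from `i`.
  refine ⟨lamC (.pr (.pr (.sigma (.cst natC) (.lam c.segTm))
    (.cst (lamC (.ap (.cst numC) (.pr0 (.var 0)))))) (.pr (.pr isFTm (.cst d₁))
      (.pr (.cst d₂) (.pr (.cst d₃) (.cst d₄))))), realizes_ball_omegaV fun i => ?_⟩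
  obtain ⟨d, hd, hd'⟩ := c.realizes_ball_memF (h := h) i
  refine ⟨pr (c.nameF i) (pr (pr d d₁) (pr d₂ (pr d₃ d₄))), ?_, ?_⟩
  · simp only [app_lamC, Tm.sigma, eval_pr, eval_cst, eval_lam, hd, Part.bind_some]
    exact Part.mem_some _
  · refine ⟨by rw [pr0_pr]; exact c.nameF_mem_V i, ?_⟩
    rw [pr0_pr, pr1_pr]
    exact realizes_and (realizes_and hd' (h₁ i)) (realizes_and (h₂ i) (realizes_and (h₃ i) (h₄ i)))

end NameF

end SeqCoding

end RealModel

theorem mainTheorem3 (c : RealModel.SeqCoding) :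
    (∃ h : ℕ → ℕ, c.MeetsAll h) ∧
    ∀ h : ℕ → ℕ, c.MeetsAll h →
      (∀ i j : ℕ, (∃ d, RealModel.Realizes (c.segs h) (c.subF (RealModel.numV i) (RealModel.numV j)) d) → i = j) ∧
      RealModel.Realizes (c.segs h)
        (.ball RealModel.omegaV fun i => .ball RealModel.omegaV fun j => .imp (c.subF i j) (.eq i j))
        (RealModel.lamC (.lam (.lam (.cst RealModel.iotaR)))) ∧
      ∃ e, RealModel.Realizes (c.segs h)
        (.ball RealModel.omegaV fun i => .ex fun y =>
          .and (c.isF y i) (.and (.subset y RealModel.omegaV) (.isOrd y))) e :=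
  ⟨c.exists_meetsAll, fun _ hh => ⟨fun _ _ ⟨_, hd⟩ => c.eq_of_realizes_subF hh hd,
    c.realizes_incomparable hh, c.exists_realizes_isOrd⟩⟩
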